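/- Let $\mathbb X\subseteq\mathbb R^d$ carry the Euclidean metric and its Borel $\sigma$-algebra, let $Q$ be a probability distribution on $\mathbb X\times\{+1,-1\}$ with input marginal $Q_X$, and let $(X_1,Y_1),(X_2,Y_2),\dots$ be i.i.d. with law $Q$. Let $\{f_\theta:\mathbb X\to[-1,1]\mid\theta\in\Theta\}$ be a family of measurable functions, indexed by an arbitrary set $\Theta$, such that $\int (f_{\theta_1}-f_{\theta_2})^2\,dQ_X\neq 0$ whenever $\theta_1\ne\theta_2$, and which contains the regression function: there is $\theta^*\in\Theta$ with $f_{\theta^*}(x)=\mathbb E[Y\mid X=x]$ for $Q_X$-almost every $x$, where $(X,Y)\sim Q$. Let $m\ge 1$ and $0\le q\le m$ be integers and let $(k_n)$ be a sequence of non-negative integers. For every $n$ let $U_{i,j}$ ($1\le i\le n$, $1\le j\le m-1$) be i.i.d. uniform on $[-1,1]$, let $\pi$ be a uniformly distributed random permutation of $\{1,\dots,m\}$, and let $\sigma$ be a random permutation of $\{1,\dots,n\}$ of any distribution (for example a constant one); these may depend on $n$ in any way, and for each fixed $n$ the sample $(X_i,Y_i)_{i\le n}$, the array $(U_{i,j})$,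 $\pi$ and $\sigma$ are mutually independent. For $\theta\in\Theta$ put $Y_{i,0}(\theta)=Y_i$ and $Y_{i,j}(\theta)=\operatorname{sign}(f_\theta(X_i)+U_{i,j})$ for $1\le j\le m-1$ (with $\operatorname{sign}(0)=1$). Let $N_n(x)$ be the set of indices of the $k_n$ points among $X_1,\dots,X_n$ that are closest to $x$ (all indices if $k_n>n$), where equal distances are ordered by $\sigma$. For $0\le j\le m-1$ let $$f^{(j)}_{\theta,n}(x)=\frac1{k_n}\sum_{i\in N_n(x)}Y_{i,j}(\theta),\qquad Z^{(j)}_n(\theta)=\frac1n\sum_{i=1}^n\bigl(f_\theta(X_i)-f^{(j)}_{\theta,n}(X_i)\bigr)^2$$ (with $1/0:=0$). Let the rank of $\theta$ be $1$ plus the number of $j\in\{1,\dots,m-1\}$ such that $Z_n^{(j)}(\theta)<Z_n^{(0)}(\theta)$, or $Z_n^{(j)}(\theta)=Z_n^{(0)}(\theta)$ and $\pi(j)<\pi(m)$, and let $\Theta_n^{(2)}$ be the random set of all $\theta\in\Theta$ whose rank is at most $q$. Then, for every $n$, $\mathbb P(\theta^*\in\Theta_n^{(2)})=q/m$. Suppose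 moreover that $q<m$, that $k_n/n\to0$, that $k_n^2/n^{1+\delta}\to\infty$ for some $\delta>0$, and that $\mathbb P(\|X-X'\|\neq\|X-X''\|)=1$ for independent $X,X',X''\sim Q_X$. Then $(\Theta_n^{(2)})$ is strongly pointwise consistent: for every $\theta\in\Theta$ with $\theta\ne\theta^*$, $$\mathbb P\Bigl(\bigcap_{n=1}^\infty\bigcup_{l=n}^\infty\{\theta\in\Theta_l^{(2)}\}\Bigr)=0 .$$ -/

import Mathlib

open MeasureTheory ProbabilityTheory Filter
open scoped ENNReal Topology

namespace KnnRegion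

/-- The output space `{+1, -1}`, with the σ-algebra inherited from `ℝ`. -/
abbrev Label : Type := ({1, -1} : Set ℝ)

/-- The label-valued sign; the value at `0` is a convention. -/
noncomputable def sgn (t : ℝ) : Label :=
  if 0 ≤ t then ⟨1, by simp⟩ else ⟨-1, by simp⟩

/-- Permutations of a finite set carry the discrete σ-algebra. -/
instance permMeasurableSpace (n : ℕ) : MeasurableSpace (Equiv.Perm (Fin n)) := ⊤

section Model

variable {𝕏 : Type*} [MeasurableSpace 𝕏]

/-- `g` is (a version of) the regression function `x ↦ E[Y | X = x]` for `(X, Y) ∼ Q`. -/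
def IsRegressionFunction (Q : Measure (𝕏 × Label)) (g : 𝕏 → ℝ) : Prop :=
  (fun p : 𝕏 × Label => g p.1) =ᵐ[Q]
    Q[fun p : 𝕏 × Label => (p.2 : ℝ) | MeasurableSpace.comap Prod.fst inferInstance]

/-- The squared `L²(Q_X)` distance `∫ (g - h)² dQ_X`, where `Q_X` is the input marginal of `Q`. -/
noncomputable def sqDistQ (Q : Measure (𝕏 × Label)) (g h : 𝕏 → ℝ) : ℝ :=
  ∫ x, (g x - h x) ^ 2 ∂Q.fst

variable {Ω : Type*} [MeasurableSpace Ω]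

/-- The observations `(X i, Y i)`, `i = 0, 1, 2, …`, are i.i.d. with law `Q`. -/
structure IsIIDSample (μ : Measure Ω) (Q : Measure (𝕏 × Label))
    (X : ℕ → Ω → 𝕏) (Y : ℕ → Ω → Label) : Prop where
  measurable_X : ∀ i, Measurable (X i)
  measurable_Y : ∀ i, Measurable (Y i)
  law : ∀ i, μ.map (fun ω => (X i ω, Y i ω)) = Q
  indep : iIndepFun (fun i ω => (X i ω, Y i ω)) μ

/-- The randomness generated by the algorithm with `m = r + 1` datasets. For every sample size `n`:
an array `U n i j` of i.i.d. uniform variables on `[-1, 1]`, a uniformly distributed permutation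
`π n` of the `m` datasets, and a permutation `σ n` of the sample indices (of any distribution, for
example constant or uniform) giving the priorities by which ties between distances are broken.
The first `n` observations, the array `U n`, `π n` and `σ n` are mutually independent.
Nothing is assumed about the joint law of the generated variables for different `n`: they may be
drawn afresh, or the array of size `n` may extend the earlier ones. -/
structure IsInitialization {r : ℕ} (μ : Measure Ω) (X : ℕ → Ω → 𝕏) (Y : ℕ → Ω → Label)
    (U : (n : ℕ) → Fin n → Fin r → Ω → ℝ) (π : ℕ → Ω → Equiv.Perm (Fin (r + 1)))
    (σ : (n : ℕ) → Ω → Equiv.Perm (Fin n)) : Prop where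
  measurable_U : ∀ n i j, Measurable (U n i j)
  measurable_π : ∀ n, Measurable (π n)
  measurable_σ : ∀ n, Measurable (σ n)
  uniform_U : ∀ n i j, pdf.IsUniform (U n i j) (Set.Icc (-1 : ℝ) 1) μ volume
  indep_U : ∀ n, iIndepFun (fun (p : Fin n × Fin r) ω => U n p.1 p.2 ω) μ
  uniform_π : ∀ n, μ.map (π n) = uniformOn Set.univ
  indep_sample : ∀ n, IndepFun (fun ω (i : Fin n) => (X i ω, Y i ω))
    (fun ω => ((fun (p : Fin n × Fin r) => U n p.1 p.2 ω), π n ω, σ n ω)) μ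
  indep_array : ∀ n, IndepFun (fun ω (p : Fin n × Fin r) => U n p.1 p.2 ω)
    (fun ω => (π n ω, σ n ω)) μ
  indep_perm : ∀ n, IndepFun (π n) (σ n) μ

end Model

section Procedure

variable {𝕏 : Type*} {n r : ℕ}

/-- The `j`-th alternative sample `(x_i, sgn (g (x_i) + u_{i,j}))`, `i = 1, …, n`, for the
candidate regression function `g`. -/
noncomputable def altSample (g : 𝕏 → ℝ) (D : Fin n → 𝕏 × Label) (u : Fin n → Fin r → ℝ)
    (j : Fin r) : Fin n → 𝕏 × Label :=
  fun i => ((D i).1, sgn (g (D i).1 + u i j))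

variable [PseudoMetricSpace 𝕏]

open Classical in
/-- The (indices of the) `k` nearest neighbours of `x` among `xs 0, …, xs (n - 1)`: those `i` that
have fewer than `k` predecessors when the indices are ordered by distance to `x`, equal distances
being ordered by the priorities `s`. -/
noncomputable def neighbors (k : ℕ) (s : Equiv.Perm (Fin n)) (xs : Fin n → 𝕏) (x : 𝕏) :
    Finset (Fin n) :=
  {i : Fin n | (Finset.card {l : Fin n | dist (xs l) x < dist (xs i) x ∨
    (dist (xs l) x = dist (xs i) x ∧ s l < s i)}) < k}

/-- The kNN regression estimate based on the dataset `D`. -/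
noncomputable def knnEstimate (k : ℕ) (s : Equiv.Perm (Fin n)) (D : Fin n → 𝕏 × Label) (x : 𝕏) :
    ℝ :=
  1 / (k : ℝ) * ∑ i ∈ neighbors k s (fun l => (D l).1) x, ((D i).2 : ℝ)

/-- The reference variable of the dataset `D`: the empirical squared distance of the candidate `g`
from the kNN estimate based on `D`. -/
noncomputable def refVar (k : ℕ) (s : Equiv.Perm (Fin n)) (g : 𝕏 → ℝ) (D : Fin n → 𝕏 × Label) :
    ℝ :=
  1 / (n : ℝ) * ∑ i, (g (D i).1 - knnEstimate k s D (D i).1) ^ 2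

open Classical in
/-- The rank of `z₀` among `z₀, z 0, …, z (r - 1)`: one plus the number of `z j` that precede `z₀`
in the order by value, ties being resolved by the permutation `p`. The original dataset has the tie
key `p (last)`, the alternative datasets have the other keys. -/
noncomputable def rank (p : Equiv.Perm (Fin (r + 1))) (z₀ : ℝ) (z : Fin r → ℝ) : ℕ :=
  1 + Finset.card {j : Fin r | z j < z₀ ∨ (z j = z₀ ∧ p j.castSucc < p (Fin.last r))}

/-- The kNN-based confidence region: all parameters `θ` for which the reference variable of the
original dataset `D` has rank at most `q` among those of `D` and its alternatives. -/
noncomputable def region {Θ : Type*} (f : Θ → 𝕏 → ℝ) (q k : ℕ) (s : Equiv.Perm (Fin n))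
    (p : Equiv.Perm (Fin (r + 1))) (D : Fin n → 𝕏 × Label) (u : Fin n → Fin r → ℝ) : Set Θ :=
  {θ | rank p (refVar k s (f θ) D) (fun j => refVar k s (f θ) (altSample (f θ) D u j)) ≤ q}

end Procedure

/-- The random region `Θ_n` built from the first `n` observations. -/
noncomputable def randomRegion {𝕏 Ω Θ : Type*} [PseudoMetricSpace 𝕏] {r : ℕ} (f : Θ → 𝕏 → ℝ)
    (q : ℕ) (k : ℕ → ℕ) (X : ℕ → Ω → 𝕏) (Y : ℕ → Ω → Label)
    (U : (n : ℕ) → Fin n → Fin r → Ω → ℝ) (π : ℕ → Ω → Equiv.Perm (Fin (r + 1)))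
    (σ : (n : ℕ) → Ω → Equiv.Perm (Fin n)) (n : ℕ) (ω : Ω) : Set Θ :=
  region f q (k n) (σ n ω) (π n ω) (fun i : Fin n => (X i ω, Y i ω)) (fun i j => U n i j ω)

end KnnRegion

/-!
Given the inputs, the labels of the original sample have the law of the signs of `f θ* + uniform`.
For `θ = θ*` all `r + 1` datasets are therefore obtained from i.i.d. columns of noise, the reference
variables are exchangeable, and randomized tie-breaking makes each rank equally likely.

Call a dataset well specified for `θ` if its labels have conditional mean `f θ`. The reference
variable of such a dataset tends to `0`: its bias vanishes for bounded continuous functions, and in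
general by density in `L²`, Stone's lemma bounding the averages over neighbours; its noise is
sub-Gaussian of variance `O(1 / k)`, so that `k / log n → ∞` allows Borel–Cantelli. The alternative
datasets are well specified for `θ`, the original one for `θ*`. By the triangle inequality, the
reference variable of the original dataset for `θ ≠ θ*` is eventually bounded below by a multiple of
`∫ (f θ - f θ*)² dQ_X`, and `θ` is ranked last.
-/

namespace KnnRegion

section Ranks

variable {ι L : Type*} [Fintype ι] [LinearOrder L]

/-- The number of indices preceding `a` in the order given by `key`; it expresses both the ranks
of the reference variables and the nearest neighbours. -/
def predCount (key : ι → L) (a : ι) : ℕ :=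
  Finset.card {l | key l < key a}

theorem card_predCount_lt {key : ι → L} (hkey : Function.Injective key) (q : ℕ) :
    Finset.card {a | predCount key a < q} = min q (Fintype.card ι) := by
  let _ : LinearOrder ι := LinearOrder.lift' key hkey
  let e : Fin (Fintype.card ι) ≃o ι := monoEquivOfFin ι rfl
  have predCount_eq (i : Fin (Fintype.card ι)) : predCount key (e i) = i := calc
    predCount key (e i) = Finset.card {j | j < i} := Eq.symm <|
      Finset.card_equiv e.toEquiv fun j => by
        rw [Finset.mem_filter_univ, Finset.mem_filter_univ]
        exact e.lt_iff_lt.symm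
    _ = i := by rw [Finset.filter_gt_eq_Iio, Fin.card_Iio]
  calc Finset.card {a | predCount key a < q} = Finset.card {i | predCount key (e i) < q} :=
      (Finset.card_equiv e.toEquiv fun i => by simp).symm
    _ = min q (Fintype.card ι) := by simp only [predCount_eq, Fin.card_filter_val_lt, min_comm]

theorem predCount_comp (key : ι → L) (τ : Equiv.Perm ι) (a : ι) :
    predCount (key ∘ τ) a = predCount key (τ a) :=
  Finset.card_equiv τ fun l => by simp

theorem predCount_eq_of_forall_lt {key : ι → L} {a : ι} (h : ∀ b ≠ a, key b < key a) :
    predCount key a = Fintype.card ι - 1 := by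
  classical
  have lt_iff (b) : key b < key a ↔ b ≠ a := ⟨fun hb => ne_of_apply_ne key hb.ne, h b⟩
  simp only [predCount, lt_iff, Finset.filter_ne', Finset.card_erase_of_mem (Finset.mem_univ a),
    Finset.card_univ]

/-- The key that orders indices by their value `z`, equal values being ordered by the
permutation `p`. -/
def lexKey {n : ℕ} (p : Equiv.Perm (Fin n)) (z : Fin n → ℝ) (i : Fin n) : ℝ ×ₗ Fin n :=
  toLex (z i, p i)

theorem lexKey_injective {n : ℕ} (p : Equiv.Perm (Fin n)) (z : Fin n → ℝ) :
    Function.Injective (lexKey p z) :=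
  fun _ _ hij => p.injective (congrArg (fun x => (ofLex x).2) hij)

theorem lexKey_lt_lexKey {n : ℕ} {p : Equiv.Perm (Fin n)} {z : Fin n → ℝ} {i j : Fin n} :
    lexKey p z i < lexKey p z j ↔ z i < z j ∨ z i = z j ∧ p i < p j :=
  Prod.Lex.toLex_lt_toLex

theorem rank_eq_one_add_predCount {r : ℕ} (p : Equiv.Perm (Fin (r + 1))) (z : Fin (r + 1) → ℝ) :
    rank p (z (Fin.last r)) (fun j => z j.castSucc) = 1 + predCount (lexKey p z) (Fin.last r) := by
  simp only [rank, predCount, lexKey_lt_lexKey, Finset.card_filter, Fin.sum_univ_castSucc]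
  simp

end Ranks

section Neighbors

variable {𝕏 : Type*} [PseudoMetricSpace 𝕏] {n k : ℕ} {s : Equiv.Perm (Fin n)} {xs : Fin n → 𝕏}
  {x : 𝕏} {i : Fin n}

theorem mem_neighbors_iff :
    i ∈ neighbors k s xs x ↔ predCount (lexKey s fun l => dist (xs l) x) i < k := by
  simp only [neighbors, predCount, lexKey_lt_lexKey, Finset.mem_filter_univ]

variable (k s xs x) in
theorem card_neighbors : (neighbors k s xs x).card = min k n := by
  calc (neighbors k s xs x).card
      = Finset.card {i | predCount (lexKey s fun l => dist (xs l) x) i < k} := by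
        congr 1; ext i; simp [mem_neighbors_iff]
    _ = min k n := by simp [card_predCount_lt (lexKey_injective s _)]

theorem card_lt_of_forall_dist_lt (hi : i ∈ neighbors k s xs x) {S : Finset (Fin n)}
    (hS : ∀ l ∈ S, dist (xs l) x < dist (xs i) x) : S.card < k :=
  (Finset.card_le_card fun l hl => by simp [lexKey_lt_lexKey, hS l hl]).trans_lt
    (mem_neighbors_iff.1 hi)

theorem dist_le_of_mem_neighbors {δ : ℝ} (hi : i ∈ neighbors k s xs x) {S : Finset (Fin n)}
    (hS : ∀ l ∈ S, dist (xs l) x ≤ δ) (hk : k ≤ S.card) : dist (xs i) x ≤ δ := by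
  by_contra! h
  exact hk.not_gt (card_lt_of_forall_dist_lt hi fun l hl => (hS l hl).trans_lt h)

end Neighbors

section Stone

open Classical in
/-- The conclusion of Stone's lemma: among finitely many distinct points, each is one of the `k`
nearest neighbours of at most `γ * k` of them. This is the only way in which the dimension of the
input space enters the consistency theorem. -/
def HasStoneBound (𝕏 : Type*) [PseudoMetricSpace 𝕏] (γ : ℕ) : Prop :=
  ∀ (n k : ℕ) (s : Equiv.Perm (Fin n)) (xs : Fin n → 𝕏), Function.Injective xs →
    ∀ l, Finset.card {i | l ∈ neighbors k s xs (xs i)} ≤ γ * k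

theorem HasStoneBound.of_isometry {𝕏 E : Type*} [MetricSpace 𝕏] [PseudoMetricSpace E]
    {γ : ℕ} (hE : HasStoneBound E γ) {φ : 𝕏 → E} (hφ : Isometry φ) : HasStoneBound 𝕏 γ := by
  intro n k s xs hxs l
  have bound := hE n k s (φ ∘ xs) (hφ.injective.comp hxs) l
  simp only [neighbors, Function.comp_apply, hφ.dist_eq] at bound ⊢
  exact bound

open Classical in
theorem card_le_of_forall_dist_lt {𝕏 : Type*} [PseudoMetricSpace 𝕏] {n k : ℕ}
    {s : Equiv.Perm (Fin n)} {xs : Fin n → 𝕏} {l : Fin n} {C : Finset (Fin n)}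
    (hmem : ∀ i ∈ C, l ∈ neighbors k s xs (xs i))
    (hC : ∀ i ∈ C, ∀ j ∈ C, dist (xs i) (xs l) ≤ dist (xs j) (xs l) →
      dist (xs i) (xs j) < dist (xs l) (xs j)) :
    C.card ≤ k := by
  rcases C.eq_empty_or_nonempty with rfl | hne
  · simp
  · obtain ⟨j, hj, hmax⟩ := C.exists_max_image (fun i => dist (xs i) (xs l)) hne
    exact (card_lt_of_forall_dist_lt (hmem j hj) fun i hi => hC i hi j hj (hmax i hi)).le

variable {E : Type*} [NormedAddCommGroup E] [NormedSpace ℝ E]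

theorem norm_sub_lt_of_norm_le {x y : E} (hx : x ≠ 0) (hxy : ‖x‖ ≤ ‖y‖)
    (h : ‖‖x‖⁻¹ • x - ‖y‖⁻¹ • y‖ < 1) : ‖x - y‖ < ‖y‖ := by
  have hx0 : 0 < ‖x‖ := norm_pos_iff.2 hx
  have hy0 : 0 < ‖y‖ := hx0.trans_le hxy
  have split : x - y = ‖x‖ • (‖x‖⁻¹ • x - ‖y‖⁻¹ • y) - (‖y‖ - ‖x‖) • (‖y‖⁻¹ • y) := by
    rw [smul_sub, sub_smul, smul_inv_smul₀ hx0.ne', smul_inv_smul₀ hy0.ne']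
    abel
  calc ‖x - y‖ ≤ ‖‖x‖ • (‖x‖⁻¹ • x - ‖y‖⁻¹ • y)‖ + ‖(‖y‖ - ‖x‖) • (‖y‖⁻¹ • y)‖ :=
        split ▸ norm_sub_le _ _
    _ = ‖x‖ * ‖‖x‖⁻¹ • x - ‖y‖⁻¹ • y‖ + (‖y‖ - ‖x‖) := by
        rw [norm_smul, norm_smul, norm_smul, norm_inv, norm_norm, norm_norm,
          inv_mul_cancel₀ hy0.ne', mul_one, Real.norm_of_nonneg (sub_nonneg.2 hxy)]
    _ < ‖x‖ * 1 + (‖y‖ - ‖x‖) := by gcongr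
    _ = ‖y‖ := by ring

theorem card_le_of_direction_mem_ball {n k : ℕ} {s : Equiv.Perm (Fin n)} {xs : Fin n → E}
    {l : Fin n} {C : Finset (Fin n)} {t : E}
    (hC : ∀ i ∈ C, xs i - xs l ≠ 0 ∧ l ∈ neighbors k s xs (xs i) ∧
      ‖xs i - xs l‖⁻¹ • (xs i - xs l) ∈ Metric.ball t (1 / 2)) :
    C.card ≤ k := by
  refine card_le_of_forall_dist_lt (fun i hi => (hC i hi).2.1) fun i hi j hj hij => ?_
  have dist_dir := (dist_triangle_right _ _ t).trans_lt (add_lt_add (hC i hi).2.2 (hC j hj).2.2)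
  rw [dist_eq_norm, add_halves] at dist_dir
  simpa [dist_eq_norm, norm_sub_rev (xs l)] using
    norm_sub_lt_of_norm_le (hC i hi).1 (by simpa [dist_eq_norm] using hij) dist_dir

open Classical in
/-- **Stone's lemma**. The directions seen from a point are covered by finitely many balls of
radius `1 / 2`, and each of these cones contains at most `k` points having it as a neighbour. -/
theorem exists_hasStoneBound (E : Type*) [NormedAddCommGroup E] [NormedSpace ℝ E]
    [FiniteDimensional ℝ E] : ∃ γ, HasStoneBound E γ := by
  have : ProperSpace E := FiniteDimensional.proper_real E
  obtain ⟨T, -, hTfin, hT⟩ := finite_cover_balls_of_compact (isCompact_sphere (0 : E) 1)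
    (one_half_pos (α := ℝ))
  lift T to Finset E using hTfin
  refine ⟨T.card + 1, fun n k s xs hxs l => ?_⟩
  rcases k.eq_zero_or_pos with rfl | hk
  · simp [mem_neighbors_iff]
  let dir (i : Fin n) : E := ‖xs i - xs l‖⁻¹ • (xs i - xs l)
  let cone (t : E) : Finset (Fin n) :=
    {i | i ≠ l ∧ l ∈ neighbors k s xs (xs i) ∧ dir i ∈ Metric.ball t (1 / 2)}
  have hne (i) (hi : i ≠ l) : xs i - xs l ≠ 0 := sub_ne_zero.2 (hxs.ne hi)
  have card_cone (t) : (cone t).card ≤ k :=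
    card_le_of_direction_mem_ball (s := s) (xs := xs) (l := l) (t := t) fun i hi => by
      obtain ⟨hil, hl, hdir⟩ := (Finset.mem_filter_univ _).1 hi
      exact ⟨hne i hil, hl, hdir⟩
  have subset_cones : ({i | l ∈ neighbors k s xs (xs i)} : Finset (Fin n)) ⊆
      insert l (T.biUnion cone) := by
    intro i hi
    rw [Finset.mem_filter_univ] at hi
    rcases eq_or_ne i l with rfl | hil
    · exact Finset.mem_insert_self _ _
    have dir_mem : dir i ∈ Metric.sphere (0 : E) 1 := by
      rw [mem_sphere_zero_iff_norm, norm_smul, norm_inv, norm_norm,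
        inv_mul_cancel₀ (norm_ne_zero_iff.2 (hne i hil))]
    obtain ⟨t, ht, hit⟩ := Set.mem_iUnion₂.1 (hT dir_mem)
    rw [Finset.mem_insert, Finset.mem_biUnion]
    exact .inr ⟨t, ht, (Finset.mem_filter_univ _).2 ⟨hil, hi, hit⟩⟩
  calc _ ≤ (insert l (T.biUnion cone)).card := Finset.card_le_card subset_cones
    _ ≤ (T.biUnion cone).card + 1 := Finset.card_insert_le _ _
    _ ≤ T.card * k + 1 := by
        gcongr
        exact Finset.card_biUnion_le_card_mul _ _ _ fun t _ => card_cone t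
    _ ≤ (T.card + 1) * k := by rw [add_one_mul]; gcongr; exact hk

end Stone

section Residual

variable {𝕏 : Type*} [PseudoMetricSpace 𝕏] {n : ℕ} (k : ℕ) (s : Equiv.Perm (Fin n))
  (xs : Fin n → 𝕏)

/-- The average of the values `a` over the `k` nearest neighbours of `x`, that is, the kNN
estimate for arbitrary real labels `a`. The normalization is `k` even if there are fewer than `k`
points, and the average is `0` for `k = 0`. -/
noncomputable def neighborAverage (a : Fin n → ℝ) (x : 𝕏) : ℝ :=
  1 / (k : ℝ) * ∑ i ∈ neighbors k s xs x, a i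

/-- The mean squared difference between the predictions `b i` and the kNN averages of the labels
`a` at the sample points. As it is a quadratic form in `(b, a)`, reference variables (`b` a
candidate, `a` labels), the squared bias (`a = b`), and the noise (`b = 0`) are compared by the
triangle inequality. -/
noncomputable def meanSqResidual (b a : Fin n → ℝ) : ℝ :=
  1 / (n : ℝ) * ∑ i, (b i - neighborAverage k s xs a (xs i)) ^ 2

theorem refVar_eq_meanSqResidual (g : 𝕏 → ℝ) (D : Fin n → 𝕏 × Label) :
    refVar k s g D = meanSqResidual k s (fun i => (D i).1) (fun i => g (D i).1)
      (fun i => ((D i).2 : ℝ)) :=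
  rfl

theorem neighborAverage_sub (a a' : Fin n → ℝ) (x : 𝕏) :
    neighborAverage k s xs (a - a') x =
      neighborAverage k s xs a x - neighborAverage k s xs a' x := by
  simp only [neighborAverage, Pi.sub_apply, Finset.sum_sub_distrib, mul_sub]

theorem neighborAverage_zero (x : 𝕏) : neighborAverage k s xs 0 x = 0 := by
  simp [neighborAverage]

theorem meanSqResidual_nonneg (b a : Fin n → ℝ) : 0 ≤ meanSqResidual k s xs b a :=
  mul_nonneg (by positivity) (Finset.sum_nonneg fun _ _ => sq_nonneg _)

theorem meanSqResidual_zero_right (b : Fin n → ℝ) :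
    meanSqResidual k s xs b 0 = 1 / (n : ℝ) * ∑ i, b i ^ 2 := by
  simp only [meanSqResidual, neighborAverage_zero, sub_zero]

theorem meanSqResidual_sub_le (b b' a a' : Fin n → ℝ) :
    meanSqResidual k s xs (b - b') (a - a') ≤
      2 * (meanSqResidual k s xs b a + meanSqResidual k s xs b' a') := by
  have sq_sub_le (i) : ((b - b') i - neighborAverage k s xs (a - a') (xs i)) ^ 2 ≤
      2 * ((b i - neighborAverage k s xs a (xs i)) ^ 2 +
        (b' i - neighborAverage k s xs a' (xs i)) ^ 2) := by
    rw [neighborAverage_sub, Pi.sub_apply, sub_sub_sub_comm, ← neg_sq (b' i - _), sub_eq_add_neg]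
    exact add_sq_le
  calc meanSqResidual k s xs (b - b') (a - a')
      ≤ 1 / (n : ℝ) * ∑ i, 2 * ((b i - neighborAverage k s xs a (xs i)) ^ 2 +
        (b' i - neighborAverage k s xs a' (xs i)) ^ 2) := by
        unfold meanSqResidual
        gcongr with i
        exact sq_sub_le i
    _ = 2 * (meanSqResidual k s xs b a + meanSqResidual k s xs b' a') := by
        simp only [meanSqResidual, ← Finset.mul_sum, Finset.sum_add_distrib]
        ring

theorem meanSqResidual_le_of_abs_le {b a : Fin n → ℝ} {t : ℝ}
    (h : ∀ i, |b i - neighborAverage k s xs a (xs i)| ≤ t) : meanSqResidual k s xs b a ≤ t ^ 2 := by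
  rcases n.eq_zero_or_pos with rfl | hn
  · simp [meanSqResidual, sq_nonneg]
  calc meanSqResidual k s xs b a ≤ 1 / (n : ℝ) * ∑ _i : Fin n, t ^ 2 := by
        unfold meanSqResidual
        gcongr 1 / (n : ℝ) * ∑ i, ?_ with i
        exact sq_le_sq' (abs_le.1 (h i)).1 (abs_le.1 (h i)).2
    _ = t ^ 2 := by simp [hn.ne']

theorem meanSqResidual_le_bias_add_noise {b a : Fin n → ℝ} {t : ℝ}
    (ht : ∀ i, |neighborAverage k s xs (b - a) (xs i)| ≤ t) :
    meanSqResidual k s xs b a ≤ 2 * (meanSqResidual k s xs b b + t ^ 2) := by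
  have noise : meanSqResidual k s xs 0 (b - a) ≤ t ^ 2 :=
    meanSqResidual_le_of_abs_le k s xs fun i => by simpa using ht i
  have triangle := meanSqResidual_sub_le k s xs b 0 b (b - a)
  rw [sub_zero, sub_sub_cancel] at triangle
  linarith

theorem mean_sq_sub_le_refVar_add_refVar (g h : 𝕏 → ℝ) (D : Fin n → 𝕏 × Label) :
    1 / (n : ℝ) * ∑ i, (g (D i).1 - h (D i).1) ^ 2 ≤ 2 * (refVar k s g D + refVar k s h D) := by
  have triangle := meanSqResidual_sub_le k s (fun i => (D i).1) (fun i => g (D i).1)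
    (fun i => h (D i).1) (fun i => ((D i).2 : ℝ)) (fun i => ((D i).2 : ℝ))
  rwa [sub_self, meanSqResidual_zero_right] at triangle

theorem sq_neighborAverage_le (a : Fin n → ℝ) (x : 𝕏) :
    neighborAverage k s xs a x ^ 2 ≤ neighborAverage k s xs (a ^ 2) x := by
  rcases k.eq_zero_or_pos with rfl | hk
  · simp [neighborAverage]
  have card_le : ((neighbors k s xs x).card : ℝ) ≤ k := by
    exact_mod_cast (card_neighbors k s xs x).trans_le (min_le_left k n)
  calc neighborAverage k s xs a x ^ 2
      = (1 / (k : ℝ)) ^ 2 * (∑ i ∈ neighbors k s xs x, a i) ^ 2 := mul_pow _ _ _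
    _ ≤ (1 / (k : ℝ)) ^ 2 * ((neighbors k s xs x).card * ∑ i ∈ neighbors k s xs x, a i ^ 2) := by
        gcongr
        exact sq_sum_le_card_mul_sum_sq
    _ ≤ (1 / (k : ℝ)) ^ 2 * (k * ∑ i ∈ neighbors k s xs x, a i ^ 2) := by gcongr
    _ = neighborAverage k s xs (a ^ 2) x := by
        simp only [neighborAverage, Pi.pow_apply]
        field_simp

theorem abs_sub_neighborAverage_le {k : ℕ} (hk : 0 < k) (hkn : k ≤ n) {c t : ℝ} {a : Fin n → ℝ}
    {x : 𝕏} (h : ∀ l ∈ neighbors k s xs x, |c - a l| ≤ t) :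
    |c - neighborAverage k s xs a x| ≤ t := by
  have hk0 : (0 : ℝ) < k := by exact_mod_cast hk
  have card_eq : (neighbors k s xs x).card = k := by rw [card_neighbors, min_eq_left hkn]
  calc |c - neighborAverage k s xs a x|
      = 1 / (k : ℝ) * |∑ l ∈ neighbors k s xs x, (c - a l)| := by
        rw [neighborAverage, Finset.sum_sub_distrib, Finset.sum_const, card_eq, nsmul_eq_mul,
          ← abs_of_pos (one_div_pos.2 hk0), ← abs_mul, abs_of_pos (one_div_pos.2 hk0), mul_sub]
        field_simp
    _ ≤ 1 / (k : ℝ) * ∑ _l ∈ neighbors k s xs x, t := by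
        gcongr
        exact (Finset.abs_sum_le_sum_abs _ _).trans (Finset.sum_le_sum h)
    _ = t := by
        rw [Finset.sum_const, card_eq, nsmul_eq_mul]
        field_simp

open Classical in
theorem meanSqResidual_self_le_of_abs_le {k : ℕ} (hk : 0 < k) (hkn : k ≤ n) {b : Fin n → ℝ}
    {M ε : ℝ} (hM : ∀ i, |b i| ≤ M) :
    meanSqResidual k s xs b b ≤ ε ^ 2 + (2 * M) ^ 2 *
      (Finset.card {i | ∃ l ∈ neighbors k s xs (xs i), ε < |b i - b l|} / (n : ℝ)) := by
  have hn : (0 : ℝ) < n := by exact_mod_cast hk.trans_le hkn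
  have sq_le (i) : (b i - neighborAverage k s xs b (xs i)) ^ 2 ≤
      ε ^ 2 + if ∃ l ∈ neighbors k s xs (xs i), ε < |b i - b l| then (2 * M) ^ 2 else 0 := by
    split_ifs with h
    · have := abs_sub_neighborAverage_le s xs hk hkn (x := xs i) (c := b i) (a := b) (t := 2 * M)
        fun l _ => (abs_sub _ _).trans (by linarith [hM i, hM l])
      nlinarith [sq_le_sq' (abs_le.1 this).1 (abs_le.1 this).2, sq_nonneg ε]
    · push Not at h
      have := abs_sub_neighborAverage_le s xs hk hkn h
      simpa using sq_le_sq' (abs_le.1 this).1 (abs_le.1 this).2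
  calc meanSqResidual k s xs b b
      ≤ 1 / (n : ℝ) * ∑ i,
        (ε ^ 2 + if ∃ l ∈ neighbors k s xs (xs i), ε < |b i - b l| then (2 * M) ^ 2 else 0) := by
        unfold meanSqResidual
        gcongr 1 / (n : ℝ) * ∑ i, ?_ with i
        exact sq_le i
    _ = _ := by
        rw [Finset.sum_add_distrib, ← Finset.sum_filter, Finset.sum_const, Finset.sum_const]
        simp only [Finset.card_univ, Fintype.card_fin, nsmul_eq_mul]
        field_simp

open Classical in
theorem HasStoneBound.sum_neighborAverage_le {γ : ℕ} (hγ : HasStoneBound 𝕏 γ) {xs : Fin n → 𝕏}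
    (hxs : Function.Injective xs) {a : Fin n → ℝ} (ha : 0 ≤ a) :
    ∑ i, neighborAverage k s xs a (xs i) ≤ γ * ∑ l, a l := by
  rcases k.eq_zero_or_pos with rfl | hk
  · simpa [neighborAverage] using mul_nonneg γ.cast_nonneg (Finset.sum_nonneg fun l _ => ha l)
  calc ∑ i, neighborAverage k s xs a (xs i)
      = 1 / (k : ℝ) * ∑ l, (Finset.card {i | l ∈ neighbors k s xs (xs i)} : ℝ) * a l := by
        simp only [neighborAverage, ← Finset.mul_sum, ← nsmul_eq_mul, ← Finset.sum_const]
        rw [Finset.sum_comm' (t' := Finset.univ)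
          (s' := fun l => {i | l ∈ neighbors k s xs (xs i)}) (by simp)]
    _ ≤ 1 / (k : ℝ) * ∑ l, (γ * k : ℝ) * a l := by
        gcongr with l
        · exact ha l
        · exact_mod_cast hγ n k s xs hxs l
    _ = γ * ∑ l, a l := by
        rw [← Finset.mul_sum]
        field_simp

theorem HasStoneBound.meanSqResidual_self_le {γ : ℕ} (hγ : HasStoneBound 𝕏 γ) {xs : Fin n → 𝕏}
    (hxs : Function.Injective xs) (b : Fin n → ℝ) :
    meanSqResidual k s xs b b ≤ 2 * (1 + γ) * (1 / (n : ℝ) * ∑ i, b i ^ 2) := by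
  have contraction : meanSqResidual k s xs 0 b ≤ γ * (1 / (n : ℝ) * ∑ i, b i ^ 2) := calc
    meanSqResidual k s xs 0 b ≤ 1 / (n : ℝ) * ∑ i, neighborAverage k s xs (b ^ 2) (xs i) := by
        simp only [meanSqResidual, Pi.zero_apply, zero_sub, neg_sq]
        gcongr with i
        exact sq_neighborAverage_le k s xs b (xs i)
    _ ≤ 1 / (n : ℝ) * (γ * ∑ i, b i ^ 2) := by
        gcongr
        exact hγ.sum_neighborAverage_le k s hxs fun i => sq_nonneg (b i)
    _ = γ * (1 / (n : ℝ) * ∑ i, b i ^ 2) := mul_left_comm _ _ _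
  have triangle := meanSqResidual_sub_le k s xs b 0 0 (-b)
  have neg_noise : meanSqResidual k s xs 0 (-b) = meanSqResidual k s xs 0 b := by
    simp [meanSqResidual, neighborAverage]
  rw [sub_zero, sub_neg_eq_add, zero_add, meanSqResidual_zero_right, neg_noise] at triangle
  linarith

end Residual

section Measurability

instance discreteMeasurableSpace_perm (n : ℕ) : DiscreteMeasurableSpace (Equiv.Perm (Fin n)) :=
  ⟨fun _ => trivial⟩

theorem measurable_sgn : Measurable sgn :=
  Measurable.ite measurableSet_Ici measurable_const measurable_const

variable {α : Type*} [MeasurableSpace α] {n : ℕ}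

theorem measurable_predCount_lexKey {p : α → Equiv.Perm (Fin n)} (hp : Measurable p)
    {z : α → Fin n → ℝ} (hz : Measurable z) (a : Fin n) :
    Measurable fun w => predCount (lexKey (p w) (z w)) a := by
  have hz' (l) : Measurable fun w => z w l := (measurable_pi_apply l).comp hz
  simp only [predCount, lexKey_lt_lexKey, Finset.card_filter]
  refine Finset.measurable_sum _ fun l _ => Measurable.ite ?_ measurable_const measurable_const
  exact (measurableSet_lt (hz' l) (hz' a)).union
    ((measurableSet_eq_fun (hz' l) (hz' a)).inter
      (hp (.of_discrete (s := {p' : Equiv.Perm (Fin n) | p' l < p' a}))))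

variable {𝕏 : Type*} [PseudoMetricSpace 𝕏] [SecondCountableTopology 𝕏] [MeasurableSpace 𝕏]
  [OpensMeasurableSpace 𝕏] (k : ℕ) {s : α → Equiv.Perm (Fin n)} {xs : α → Fin n → 𝕏}

theorem measurableSet_mem_neighbors (hs : Measurable s) (hxs : Measurable xs) {x : α → 𝕏}
    (hx : Measurable x) (i : Fin n) : MeasurableSet {w | i ∈ neighbors k (s w) (xs w) (x w)} := by
  simp only [mem_neighbors_iff]
  exact measurable_predCount_lexKey hs
    (measurable_pi_lambda _ fun l => ((measurable_pi_apply l).comp hxs).dist hx) i measurableSet_Iio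

theorem measurable_neighborAverage (hs : Measurable s) (hxs : Measurable xs) {a : α → Fin n → ℝ}
    (ha : Measurable a) {x : α → 𝕏} (hx : Measurable x) :
    Measurable fun w => neighborAverage k (s w) (xs w) (a w) (x w) := by
  classical
  have sum_eq (w) : ∑ i ∈ neighbors k (s w) (xs w) (x w), a w i =
      ∑ i, if i ∈ neighbors k (s w) (xs w) (x w) then a w i else 0 := by
    rw [← Finset.sum_filter, Finset.filter_univ_mem]
  simp only [neighborAverage, sum_eq]
  exact (Finset.measurable_sum _ fun i _ => Measurable.ite
    (measurableSet_mem_neighbors k hs hxs hx i) ((measurable_pi_apply i).comp ha)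
    measurable_const).const_mul _

theorem measurable_refVar {g : 𝕏 → ℝ} (hg : Measurable g) (hs : Measurable s)
    {D : α → Fin n → 𝕏 × Label} (hD : Measurable D) :
    Measurable fun w => refVar k (s w) g (D w) := by
  have hD' (i) : Measurable fun w => D w i := (measurable_pi_apply i).comp hD
  simp only [refVar_eq_meanSqResidual, meanSqResidual]
  refine (Finset.measurable_sum _ fun i _ => ?_).const_mul _
  refine ((hg.comp (hD' i).fst).sub ?_).pow_const 2
  exact measurable_neighborAverage k hs (measurable_pi_lambda _ fun l => (hD' l).fst)
    (measurable_pi_lambda _ fun l => measurable_subtype_coe.comp (hD' l).snd) (hD' i).fst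

end Measurability

section LabelLaw

/-- The uniform distribution on `[-1, 1]`. -/
noncomputable def unif : Measure ℝ := volume[|Set.Icc (-1 : ℝ) 1]

instance isProbabilityMeasure_unif : IsProbabilityMeasure unif :=
  cond_isProbabilityMeasure_of_finite (by simp) (by simp)

theorem unif_real_nonneg_add {a : ℝ} (ha : a ∈ Set.Icc (-1 : ℝ) 1) :
    unif.real {v | 0 ≤ a + v} = (1 + a) / 2 := by
  have inter_eq : Set.Icc (-1 : ℝ) 1 ∩ {v | 0 ≤ a + v} = Set.Icc (-a) 1 := by
    ext v
    simp only [Set.mem_inter_iff, Set.mem_Icc, Set.mem_ofPred_eq]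
    constructor <;> intro h <;> constructor <;> grind
  rw [unif, measureReal_def, cond_apply measurableSet_Icc, inter_eq, ENNReal.toReal_mul,
    ENNReal.toReal_inv, ← measureReal_def, ← measureReal_def,
    Real.volume_real_Icc_of_le (by norm_num), Real.volume_real_Icc_of_le (by linarith [ha.1])]
  ring

theorem abs_label (y : Label) : |(y : ℝ)| = 1 := by
  rcases y with ⟨_, rfl | rfl⟩ <;> simp

theorem integral_sgn_add_unif {a : ℝ} (ha : a ∈ Set.Icc (-1 : ℝ) 1) :
    ∫ v, (sgn (a + v) : ℝ) ∂unif = a := by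
  have hm : MeasurableSet {v : ℝ | 0 ≤ a + v} := measurableSet_le (by fun_prop) (by fun_prop)
  have sgn_eq (v) : (sgn (a + v) : ℝ) = 2 * Set.indicator {v | 0 ≤ a + v} 1 v - 1 := by
    by_cases hv : 0 ≤ a + v
    · norm_num [sgn, hv]
    · simp [sgn, hv]
  have indicator_integrable : Integrable ({v : ℝ | 0 ≤ a + v}.indicator (1 : ℝ → ℝ)) unif :=
    (integrable_const 1).indicator hm
  simp_rw [sgn_eq]
  rw [integral_sub (indicator_integrable.const_mul 2) (integrable_const 1), integral_const_mul,
    integral_indicator_one hm, unif_real_nonneg_add ha, integral_const, probReal_univ]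
  simp
  ring

variable {𝕏 : Type*} [MeasurableSpace 𝕏]

theorem integrable_label (P : Measure (𝕏 × Label)) [IsFiniteMeasure P] :
    Integrable (fun p : 𝕏 × Label => (p.2 : ℝ)) P :=
  .of_bound (measurable_subtype_coe.comp measurable_snd).aestronglyMeasurable 1
    (.of_forall fun p => (abs_label p.2).le)

/-- Every function of a label is affine, so a law on `𝕏 × Label` is determined by its input marginal
and the mean label on every measurable set of inputs. -/
theorem ext_of_fst_of_setIntegral {P P' : Measure (𝕏 × Label)} [IsFiniteMeasure P]
    [IsFiniteMeasure P'] (hfst : P.fst = P'.fst)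
    (hint : ∀ A : Set 𝕏, MeasurableSet A →
      ∫ p in Prod.fst ⁻¹' A, (p.2 : ℝ) ∂P = ∫ p in Prod.fst ⁻¹' A, (p.2 : ℝ) ∂P') : P = P' := by
  refine Measure.ext_prod fun {A t} hA ht => ?_
  obtain ⟨c, d, affine⟩ : ∃ c d : ℝ, ∀ y : Label, t.indicator 1 y = c + d * (y : ℝ) := by
    let e (ε : ℝ) (hε : ε ∈ ({1, -1} : Set ℝ)) : ℝ := t.indicator 1 (⟨ε, hε⟩ : Label)
    refine ⟨(e 1 (by simp) + e (-1) (by simp)) / 2, (e 1 (by simp) - e (-1) (by simp)) / 2, ?_⟩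
    rintro ⟨_, rfl | rfl⟩ <;> simp only [e] <;> ring
  have real_prod (ν : Measure (𝕏 × Label)) [IsFiniteMeasure ν] : ν.real (A ×ˢ t) =
      c * ν.fst.real A + d * ∫ p in Prod.fst ⁻¹' A, (p.2 : ℝ) ∂ν := by
    calc ν.real (A ×ˢ t) = ∫ p in Prod.fst ⁻¹' A, (Prod.snd ⁻¹' t).indicator 1 p ∂ν := by
          rw [integral_indicator_one (measurable_snd ht), measureReal_restrict_apply
            (measurable_snd ht), Set.inter_comm, Set.prod_eq]
      _ = ∫ p in Prod.fst ⁻¹' A, (c + d * (p.2 : ℝ)) ∂ν :=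
          integral_congr_ae (.of_forall fun p => affine p.2)
      _ = _ := by
          rw [integral_add (integrable_const c) ((integrable_label ν).integrableOn.const_mul d),
            integral_const, integral_const_mul, measureReal_restrict_apply_univ, smul_eq_mul,
            mul_comm, measureReal_def ν.fst, Measure.fst_apply hA, measureReal_def]
  rw [← measureReal_eq_measureReal_iff, real_prod P, real_prod P', hfst, hint A hA]

/-- The labelling rule behind the alternative samples: the input `p.1` receives a label with
conditional mean `g p.1` if the noise `p.2` is uniform on `[-1, 1]`. -/
noncomputable def drawLabel (g : 𝕏 → ℝ) (p : 𝕏 × ℝ) : 𝕏 × Label :=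
  (p.1, sgn (g p.1 + p.2))

theorem measurable_drawLabel {g : 𝕏 → ℝ} (hg : Measurable g) : Measurable (drawLabel g) :=
  measurable_fst.prodMk (measurable_sgn.comp ((hg.comp measurable_fst).add measurable_snd))

theorem IsRegressionFunction.setIntegral_label {Q : Measure (𝕏 × Label)} [IsFiniteMeasure Q]
    {g : 𝕏 → ℝ} (hQ : IsRegressionFunction Q g) {A : Set 𝕏} (hA : MeasurableSet A) :
    ∫ p in Prod.fst ⁻¹' A, (p.2 : ℝ) ∂Q = ∫ p in Prod.fst ⁻¹' A, g p.1 ∂Q := by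
  rw [← setIntegral_condExp measurable_fst.comap_le (integrable_label Q) ⟨A, hA, rfl⟩]
  exact setIntegral_congr_ae (measurable_fst hA) (hQ.mono fun p hp _ => hp.symm)

theorem IsRegressionFunction.measurePreserving_drawLabel {Q : Measure (𝕏 × Label)}
    [IsFiniteMeasure Q] {g : 𝕏 → ℝ} (hg : Measurable g) (hg1 : ∀ x, g x ∈ Set.Icc (-1 : ℝ) 1)
    (hQ : IsRegressionFunction Q g) :
    MeasurePreserving (drawLabel g) (Q.fst.prod unif) Q := by
  have hdraw := measurable_drawLabel hg
  refine ⟨hdraw, ext_of_fst_of_setIntegral ?_ fun A hA => ?_⟩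
  · rw [Measure.fst, Measure.map_map measurable_fst hdraw]
    exact Measure.fst_prod
  · have label_integrable : Integrable (fun p => ((drawLabel g p).2 : ℝ)) (Q.fst.prod unif) :=
      (integrable_label _).comp_measurable hdraw
    calc ∫ p in Prod.fst ⁻¹' A, (p.2 : ℝ) ∂(Q.fst.prod unif).map (drawLabel g)
        = ∫ p in A ×ˢ Set.univ, ((drawLabel g p).2 : ℝ) ∂Q.fst.prod unif := by
          rw [setIntegral_map (measurable_fst hA) (integrable_label _).aestronglyMeasurable
            hdraw.aemeasurable, Set.prod_univ]
          rfl
      _ = ∫ x in A, g x ∂Q.fst := by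
          rw [setIntegral_prod _ label_integrable.integrableOn, Measure.restrict_univ]
          exact integral_congr_ae (.of_forall fun x => integral_sgn_add_unif (hg1 x))
      _ = ∫ p in Prod.fst ⁻¹' A, (p.2 : ℝ) ∂Q := by
          rw [hQ.setIntegral_label hA, Measure.fst, setIntegral_map hA
            hg.aestronglyMeasurable measurable_fst.aemeasurable]

end LabelLaw

section Exchangeability

variable {ι κ S : Type*} [Fintype ι] [Fintype κ] [MeasurableSpace S] (ν : Measure S)

theorem measurePreserving_transpose [SigmaFinite ν] :
    MeasurePreserving (fun (c : κ → ι → S) (p : ι × κ) => c p.2 p.1)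
      (Measure.pi fun _ => Measure.pi fun _ => ν) (Measure.pi fun _ => ν) := by
  have hm : Measurable fun (c : κ → ι → S) (p : ι × κ) => c p.2 p.1 := by fun_prop
  refine ⟨hm, (Measure.pi_eq fun s hs => ?_).symm⟩
  have preimage_pi : (fun (c : κ → ι → S) (p : ι × κ) => c p.2 p.1) ⁻¹' Set.univ.pi s =
      Set.univ.pi fun j => Set.univ.pi fun i => s (i, j) := by
    ext c
    simp only [Set.mem_preimage, Set.mem_univ_pi, Prod.forall]
    exact forall_comm
  rw [Measure.map_apply hm (.univ_pi hs), preimage_pi, Measure.pi_pi]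
  simp only [Measure.pi_pi]
  rw [Fintype.prod_prod_type_right]

theorem measurePreserving_comp_perm [SigmaFinite ν] (τ : Equiv.Perm κ) :
    MeasurePreserving (fun c : κ → S => c ∘ τ) (Measure.pi fun _ => ν) (Measure.pi fun _ => ν) :=
  measurePreserving_arrowCongr' (fun _ => ν) (fun _ => ν) τ.symm (.refl S) fun _ => .id ν

theorem measurePreserving_perm_trans {m : ℕ} (τ : Equiv.Perm (Fin m)) :
    MeasurePreserving (fun p : Equiv.Perm (Fin m) => τ.trans p) (uniformOn Set.univ)
      (uniformOn Set.univ) := by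
  have count_preserved : MeasurePreserving (fun p : Equiv.Perm (Fin m) => τ.trans p)
      Measure.count Measure.count := measurePreserving_mul_right Measure.count τ
  rw [uniformOn, ProbabilityTheory.cond, Measure.restrict_univ]
  exact count_preserved.smul_measure _

theorem measurePreserving_regroup {α β γ δ : Type*} [MeasurableSpace α] [MeasurableSpace β]
    [MeasurableSpace γ] [MeasurableSpace δ] (a : Measure α) (b : Measure β) (c : Measure γ)
    (d : Measure δ) [SFinite a] [SFinite b] [SFinite c] [SFinite d] :
    MeasurePreserving (fun w : α × (β × γ) × δ => ((w.1, w.2.1.1), (w.2.1.2, w.2.2)))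
      (a.prod ((b.prod c).prod d)) ((a.prod b).prod (c.prod d)) :=
  (measurePreserving_prodAssoc a b (c.prod d)).symm.comp
    ((MeasurePreserving.id a).prod (measurePreserving_prodAssoc b c d))

end Exchangeability

section Laws

variable {𝕏 : Type*} {n r : ℕ}

/-- What the procedure works with: the sample, the array of noise variables, and the permutations
that resolve ties between reference variables and between distances. -/
abbrev Observation (𝕏 : Type*) (n r : ℕ) : Type _ :=
  (Fin n → 𝕏 × Label) × (Fin n × Fin r → ℝ) × Equiv.Perm (Fin (r + 1)) × Equiv.Perm (Fin n)

/-- A realization of inputs, one column of noise for each of the `r + 1` datasets, and the two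
permutations. Drawing the labels of the original sample from the last column of noise treats all
datasets alike. -/
abbrev Seed (𝕏 : Type*) (n r : ℕ) : Type _ :=
  (Fin n → 𝕏) × (Fin (r + 1) → Fin n → ℝ) × Equiv.Perm (Fin (r + 1)) × Equiv.Perm (Fin n)

/-- The inputs `x`, labelled by means of `g` and the noise variables `v`. -/
noncomputable def labelled (g : 𝕏 → ℝ) (x : Fin n → 𝕏) (v : Fin n → ℝ) : Fin n → 𝕏 × Label :=
  fun i => drawLabel g (x i, v i)

/-- The observation produced by a seed when the original sample has regression function `g`. -/
noncomputable def observed (g : 𝕏 → ℝ) (w : Seed 𝕏 n r) : Observation 𝕏 n r :=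
  (labelled g w.1 (w.2.1 (Fin.last r)), fun p => w.2.1 p.2.castSucc p.1, w.2.2)

variable [MeasurableSpace 𝕏]

/-- The law of an observation: the sample is i.i.d. from `Q`, the array is i.i.d. uniform on
`[-1, 1]`, and the permutations have laws `uniformOn Set.univ` and `S`, all independent. -/
noncomputable def observationLaw (Q : Measure (𝕏 × Label)) (r : ℕ)
    (S : Measure (Equiv.Perm (Fin n))) : Measure (Observation 𝕏 n r) :=
  (Measure.pi fun _ => Q).prod ((Measure.pi fun _ => unif).prod ((uniformOn Set.univ).prod S))

/-- The law of a seed with i.i.d. inputs of law `P`. -/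
noncomputable def seedLaw (P : Measure 𝕏) (r : ℕ) (S : Measure (Equiv.Perm (Fin n))) :
    Measure (Seed 𝕏 n r) :=
  (Measure.pi fun _ => P).prod
    ((Measure.pi fun _ => Measure.pi fun _ => unif).prod ((uniformOn Set.univ).prod S))

instance isProbabilityMeasure_seedLaw (P : Measure 𝕏) [IsProbabilityMeasure P]
    (S : Measure (Equiv.Perm (Fin n))) [IsProbabilityMeasure S] :
    IsProbabilityMeasure (seedLaw P r S) := by
  unfold seedLaw; infer_instance

theorem measurable_labelled {g : 𝕏 → ℝ} (hg : Measurable g) :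
    Measurable fun p : (Fin n → 𝕏) × (Fin n → ℝ) => labelled g p.1 p.2 :=
  measurable_pi_lambda _ fun i => (measurable_drawLabel hg).comp (by fun_prop)

theorem measurable_observed {g : 𝕏 → ℝ} (hg : Measurable g) :
    Measurable (observed (n := n) (r := r) g) :=
  .prodMk ((measurable_labelled hg).comp (f := fun w : Seed 𝕏 n r => (w.1, w.2.1 (Fin.last r)))
    (by fun_prop)) (by fun_prop)

variable {Q : Measure (𝕏 × Label)} [IsProbabilityMeasure Q] {g : 𝕏 → ℝ}

theorem IsRegressionFunction.measurePreserving_labelled (hQ : IsRegressionFunction Q g)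
    (hg : Measurable g) (hg1 : ∀ x, g x ∈ Set.Icc (-1 : ℝ) 1) :
    MeasurePreserving (fun p : (Fin n → 𝕏) × (Fin n → ℝ) => labelled g p.1 p.2)
      ((Measure.pi fun _ => Q.fst).prod (Measure.pi fun _ => unif)) (Measure.pi fun _ => Q) :=
  (measurePreserving_pi _ _ fun _ : Fin n => hQ.measurePreserving_drawLabel hg hg1).comp
    (measurePreserving_arrowProdEquivProdArrow 𝕏 ℝ (Fin n) (fun _ => Q.fst) fun _ => unif).symm

theorem IsRegressionFunction.measurePreserving_observed (hQ : IsRegressionFunction Q g)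
    (hg : Measurable g) (hg1 : ∀ x, g x ∈ Set.Icc (-1 : ℝ) 1)
    (S : Measure (Equiv.Perm (Fin n))) [IsProbabilityMeasure S] :
    MeasurePreserving (observed (r := r) g) (seedLaw Q.fst r S) (observationLaw Q r S) := by
  let inputs : Measure (Fin n → 𝕏) := Measure.pi fun _ => Q.fst
  let column : Measure (Fin n → ℝ) := Measure.pi fun _ => unif
  let perms := (uniformOn (Set.univ : Set (Equiv.Perm (Fin (r + 1))))).prod S
  have (m : ℕ) : SFinite ((Measure.pi fun _ : Fin m => column).prod perms) :=
    Measure.prod.instSFinite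
  have split_last := (MeasurePreserving.id inputs).prod
    ((measurePreserving_piFinSuccAbove (fun _ => column) (Fin.last r)).prod
      (MeasurePreserving.id perms))
  have regroup := measurePreserving_regroup inputs column (Measure.pi fun _ : Fin r => column) perms
  have label := (hQ.measurePreserving_labelled (n := n) hg hg1).prod
    ((measurePreserving_transpose (ι := Fin n) (κ := Fin r) unif).prod (MeasurePreserving.id perms))
  unfold seedLaw observationLaw
  convert label.comp (regroup.comp split_last) using 1
  funext w
  simp [observed, Fin.init]

end Laws

section Transfer

variable {𝕏 Ω : Type*} [MeasurableSpace 𝕏] [MeasurableSpace Ω] {μ : Measure Ω}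
  [IsProbabilityMeasure μ] {Q : Measure (𝕏 × Label)} {X : ℕ → Ω → 𝕏} {Y : ℕ → Ω → Label} {r : ℕ}
  {U : (n : ℕ) → Fin n → Fin r → Ω → ℝ} {π : ℕ → Ω → Equiv.Perm (Fin (r + 1))}
  {σ : (n : ℕ) → Ω → Equiv.Perm (Fin n)}

/-- The random observation on which the region of sample size `n` is based. -/
def observation (X : ℕ → Ω → 𝕏) (Y : ℕ → Ω → Label) (U : (n : ℕ) → Fin n → Fin r → Ω → ℝ)
    (π : ℕ → Ω → Equiv.Perm (Fin (r + 1))) (σ : (n : ℕ) → Ω → Equiv.Perm (Fin n)) (n : ℕ) (ω : Ω) :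
    Observation 𝕏 n r :=
  (fun i => (X i ω, Y i ω), fun p => U n p.1 p.2 ω, π n ω, σ n ω)

theorem IsIIDSample.measurePreserving_observation (hs : IsIIDSample μ Q X Y)
    (hi : IsInitialization μ X Y U π σ) (n : ℕ) :
    MeasurePreserving (observation X Y U π σ n) μ (observationLaw Q r (μ.map (σ n))) := by
  have hXY (i) : Measurable fun ω => (X i ω, Y i ω) :=
    (hs.measurable_X i).prodMk (hs.measurable_Y i)
  have hD : Measurable fun ω (i : Fin n) => (X i ω, Y i ω) := measurable_pi_lambda _ fun i => hXY i
  have hU : Measurable fun ω (p : Fin n × Fin r) => U n p.1 p.2 ω :=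
    measurable_pi_lambda _ fun p => hi.measurable_U n p.1 p.2
  have hπ := hi.measurable_π n
  have hσ := hi.measurable_σ n
  have sample_law : μ.map (fun ω (i : Fin n) => (X i ω, Y i ω)) = Measure.pi fun _ => Q := by
    rw [iIndepFun.map_fun_eq_pi_map (fun i : Fin n => (hXY i).aemeasurable)
      (hs.indep.precomp Fin.val_injective)]
    simp only [hs.law]
  have array_law :
      μ.map (fun ω (p : Fin n × Fin r) => U n p.1 p.2 ω) = Measure.pi fun _ => unif := by
    rw [iIndepFun.map_fun_eq_pi_map (fun p : Fin n × Fin r =>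
      (hi.measurable_U n p.1 p.2).aemeasurable) (hi.indep_U n)]
    exact congrArg Measure.pi (funext fun p => hi.uniform_U n p.1 p.2)
  refine ⟨hD.prodMk (hU.prodMk (hπ.prodMk hσ)), ?_⟩
  unfold observation
  rw [(indepFun_iff_map_prod_eq_prod_map_map hD.aemeasurable
      (hU.prodMk (hπ.prodMk hσ)).aemeasurable).1 (hi.indep_sample n),
    (indepFun_iff_map_prod_eq_prod_map_map hU.aemeasurable
      (hπ.prodMk hσ).aemeasurable).1 (hi.indep_array n),
    (indepFun_iff_map_prod_eq_prod_map_map hπ.aemeasurable hσ.aemeasurable).1 (hi.indep_perm n),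
    sample_law, array_law, hi.uniform_π n, observationLaw]

theorem IsIIDSample.identDistrib_observation [IsProbabilityMeasure Q] (hs : IsIIDSample μ Q X Y)
    (hi : IsInitialization μ X Y U π σ) {g : 𝕏 → ℝ} (hQ : IsRegressionFunction Q g)
    (hg : Measurable g) (hg1 : ∀ x, g x ∈ Set.Icc (-1 : ℝ) 1) (n : ℕ) :
    IdentDistrib (observation X Y U π σ n) (observed g) μ (seedLaw Q.fst r (μ.map (σ n))) := by
  have := Measure.isProbabilityMeasure_map (hi.measurable_σ n).aemeasurable (μ := μ)
  have on_sample := hs.measurePreserving_observation hi n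
  have on_seed := hQ.measurePreserving_observed hg hg1 (μ.map (σ n)) (r := r)
  exact ⟨on_sample.aemeasurable, on_seed.aemeasurable, on_sample.map_eq.trans on_seed.map_eq.symm⟩

end Transfer

section Coverage

theorem measure_predCount_lt_of_exchangeable {α : Type*} [MeasurableSpace α] {ν : Measure α}
    [IsProbabilityMeasure ν] {m : ℕ} {p : α → Equiv.Perm (Fin m)} (hp : Measurable p)
    {z : α → Fin m → ℝ} (hz : Measurable z)
    (hexch : ∀ τ : Equiv.Perm (Fin m),
      IdentDistrib (fun w => (τ.trans (p w), z w ∘ τ)) (fun w => (p w, z w)) ν ν)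
    {q : ℕ} (hq : q ≤ m) (a : Fin m) :
    ν {w | predCount (lexKey (p w) (z w)) a < q} = (q : ℝ≥0∞) / (m : ℝ≥0∞) := by
  let A (b : Fin m) : Set α := {w | predCount (lexKey (p w) (z w)) b < q}
  have hA (b) : MeasurableSet (A b) := measurable_predCount_lexKey hp hz b measurableSet_Iio
  have measure_eq (b) : ν (A b) = ν (A a) := by
    have := (hexch (Equiv.swap b a)).measure_mem_eq (s := {pz | predCount (lexKey pz.1 pz.2) a < q})
      (measurable_predCount_lexKey measurable_fst measurable_snd a measurableSet_Iio)
    refine Eq.trans (congrArg ν (Set.ext fun w => ?_)) this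
    have predCount_swap := predCount_comp (lexKey (p w) (z w)) (Equiv.swap b a) a
    rw [Equiv.swap_apply_right] at predCount_swap
    exact (congrArg (· < q) predCount_swap.symm).to_iff
  have sum_indicator (w) : ∑ b, (A b).indicator (1 : α → ℝ≥0∞) w = q := by
    classical
    have card_eq := card_predCount_lt (lexKey_injective (p w) (z w)) q
    rw [Fintype.card_fin, min_eq_left hq, Finset.card_filter] at card_eq
    rw [← card_eq, Nat.cast_sum]
    exact Finset.sum_congr rfl fun b _ => by simp [A, Set.indicator_apply]
  have sum_measure : ∑ b, ν (A b) = q := calc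
    ∑ b, ν (A b) = ∑ b, ∫⁻ w, (A b).indicator 1 w ∂ν := by
      simp_rw [lintegral_indicator_one (hA _)]
    _ = ∫⁻ w, ∑ b, (A b).indicator 1 w ∂ν :=
      (lintegral_finsetSum _ fun b _ => measurable_one.indicator (hA b)).symm
    _ = q := by simp [sum_indicator]
  have hm : (m : ℝ≥0∞) ≠ 0 := by exact_mod_cast a.pos.ne'
  simp only [measure_eq, Finset.sum_const, Finset.card_univ, Fintype.card_fin, nsmul_eq_mul]
    at sum_measure
  rw [← sum_measure, mul_comm, ENNReal.mul_div_cancel_right hm (ENNReal.natCast_ne_top _)]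

variable {𝕏 : Type*} {n r : ℕ}

/-- The `r + 1` samples compared by the procedure: the alternative samples for the candidate `g`,
followed by the original sample. -/
noncomputable def datasets (g : 𝕏 → ℝ) (o : Observation 𝕏 n r) : Fin (r + 1) → Fin n → 𝕏 × Label :=
  Fin.snoc (altSample g o.1 fun i j => o.2.1 (i, j)) o.1

theorem datasets_observed {g h : 𝕏 → ℝ} {j : Fin (r + 1)} (hgh : j = Fin.last r → g = h)
    (w : Seed 𝕏 n r) : datasets g (observed h w) j = labelled g w.1 (w.2.1 j) := by
  cases j using Fin.lastCases with
  | last =>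
    obtain rfl := hgh rfl
    exact Fin.snoc_last (α := fun _ => _) _ _
  | cast j => exact Fin.snoc_castSucc (α := fun _ => _) _ _ _

theorem datasets_fst (g : 𝕏 → ℝ) (o : Observation 𝕏 n r) (j : Fin (r + 1)) (i : Fin n) :
    (datasets g o j i).1 = (o.1 i).1 := by
  cases j using Fin.lastCases with
  | last => simp only [datasets, Fin.snoc_last]
  | cast j => simp only [datasets, Fin.snoc_castSucc, altSample]

theorem measurable_datasets [MeasurableSpace 𝕏] {g : 𝕏 → ℝ} (hg : Measurable g) :
    Measurable (datasets (n := n) (r := r) g) := by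
  refine measurable_pi_lambda _ fun j => ?_
  cases j using Fin.lastCases with
  | last => simpa only [datasets, Fin.snoc_last] using measurable_fst
  | cast j =>
    simp only [datasets, Fin.snoc_castSucc]
    exact measurable_pi_lambda _ fun i => (measurable_drawLabel hg).comp
      (f := fun o : Observation 𝕏 n r => ((o.1 i).1, o.2.1 (i, j))) (by fun_prop)

variable [PseudoMetricSpace 𝕏]

/-- The reference variables of all `r + 1` samples, that of the original sample being the last. -/
noncomputable def refVars (k : ℕ) (g : 𝕏 → ℝ) (o : Observation 𝕏 n r) (j : Fin (r + 1)) : ℝ :=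
  refVar k o.2.2.2 g (datasets g o j)

theorem mem_randomRegion_iff {Ω Θ : Type*} {f : Θ → 𝕏 → ℝ} {q : ℕ} {k : ℕ → ℕ} {X : ℕ → Ω → 𝕏}
    {Y : ℕ → Ω → Label} {U : (n : ℕ) → Fin n → Fin r → Ω → ℝ}
    {π : ℕ → Ω → Equiv.Perm (Fin (r + 1))} {σ : (n : ℕ) → Ω → Equiv.Perm (Fin n)} {ω : Ω} {θ : Θ} :
    θ ∈ randomRegion f q k X Y U π σ n ω ↔
      predCount (lexKey (π n ω) (refVars (k n) (f θ) (observation X Y U π σ n ω))) (Fin.last r)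
        < q := by
  have rank_eq := rank_eq_one_add_predCount (π n ω)
    (refVars (k n) (f θ) (observation X Y U π σ n ω))
  simp only [refVars, datasets, Fin.snoc_last, Fin.snoc_castSucc] at rank_eq
  rw [Nat.lt_iff_add_one_le, add_comm]
  exact (congrArg (· ≤ q) rank_eq).to_iff

variable [SecondCountableTopology 𝕏] [MeasurableSpace 𝕏] [OpensMeasurableSpace 𝕏]

theorem measurable_refVars (k : ℕ) {g : 𝕏 → ℝ} (hg : Measurable g) :
    Measurable (refVars (n := n) (r := r) k g) :=
  measurable_pi_lambda _ fun j => measurable_refVar k hg (by fun_prop)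
    ((measurable_pi_apply j).comp (measurable_datasets hg))

theorem identDistrib_refVars_observed (P : Measure 𝕏) [IsProbabilityMeasure P]
    (S : Measure (Equiv.Perm (Fin n))) [IsProbabilityMeasure S] (k : ℕ) {g : 𝕏 → ℝ}
    (hg : Measurable g) (τ : Equiv.Perm (Fin (r + 1))) :
    IdentDistrib (fun w => (τ.trans w.2.2.1, refVars k g (observed g w) ∘ τ))
      (fun w => (w.2.2.1, refVars k g (observed g w))) (seedLaw P r S) (seedLaw P r S) := by
  have refVars_eq (w : Seed 𝕏 n r) : refVars k g (observed g w) =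
      fun j => refVar k w.2.2.2 g (labelled g w.1 (w.2.1 j)) :=
    funext fun j => by rw [refVars, datasets_observed fun _ => rfl]; rfl
  have measurable_keys : Measurable fun w : Seed 𝕏 n r =>
      (w.2.2.1, refVars k g (observed g w)) :=
    Measurable.prodMk (by fun_prop) ((measurable_refVars k hg).comp (measurable_observed hg))
  have : SFinite ((Measure.pi fun _ : Fin (r + 1) => Measure.pi fun _ : Fin n => unif).prod
    ((uniformOn (Set.univ : Set (Equiv.Perm (Fin (r + 1))))).prod S)) := Measure.prod.instSFinite
  have permute_datasets : MeasurePreserving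
      (Prod.map id (Prod.map (· ∘ τ) (Prod.map (τ.trans ·) id))) (seedLaw P r S) (seedLaw P r S) :=
    (MeasurePreserving.id _).prod ((measurePreserving_comp_perm _ τ).prod
      ((measurePreserving_perm_trans τ).prod (MeasurePreserving.id S)))
  have permuted : IdentDistrib _ id (seedLaw P r S) (seedLaw P r S) :=
    ⟨permute_datasets.aemeasurable, aemeasurable_id,
      by rw [permute_datasets.map_eq, Measure.map_id]⟩
  convert permuted.comp measurable_keys using 1
  · funext w
    simp only [Function.comp_apply, refVars_eq]
    rfl
  · rfl

theorem measure_mem_randomRegion {Ω Θ : Type*} [MeasurableSpace Ω] {μ : Measure Ω}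
    [IsProbabilityMeasure μ] {Q : Measure (𝕏 × Label)} [IsProbabilityMeasure Q] {X : ℕ → Ω → 𝕏}
    {Y : ℕ → Ω → Label} {U : (n : ℕ) → Fin n → Fin r → Ω → ℝ}
    {π : ℕ → Ω → Equiv.Perm (Fin (r + 1))} {σ : (n : ℕ) → Ω → Equiv.Perm (Fin n)}
    (hs : IsIIDSample μ Q X Y) (hi : IsInitialization μ X Y U π σ) {f : Θ → 𝕏 → ℝ} {θ : Θ}
    (hQ : IsRegressionFunction Q (f θ)) (hf : Measurable (f θ))
    (hf1 : ∀ x, f θ x ∈ Set.Icc (-1 : ℝ) 1) {q : ℕ} (hq : q ≤ r + 1) (k : ℕ → ℕ) (n : ℕ) :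
    μ {ω | θ ∈ randomRegion f q k X Y U π σ n ω} = (q : ℝ≥0∞) / ((r + 1 : ℕ) : ℝ≥0∞) := by
  have := Measure.isProbabilityMeasure_map (hi.measurable_σ n).aemeasurable (μ := μ)
  have transfer := hs.identDistrib_observation hi hQ hf hf1 n
  have measurable_vars := measurable_refVars (n := n) (r := r) (k n) hf
  calc μ {ω | θ ∈ randomRegion f q k X Y U π σ n ω}
      = seedLaw Q.fst r (μ.map (σ n)) {w | predCount (lexKey w.2.2.1
          (refVars (k n) (f θ) (observed (f θ) w))) (Fin.last r) < q} := by
        simp only [mem_randomRegion_iff]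
        exact transfer.measure_mem_eq
          (s := {o | predCount (lexKey o.2.2.1 (refVars (k n) (f θ) o)) (Fin.last r) < q})
          (measurable_predCount_lexKey (by fun_prop) measurable_vars _ measurableSet_Iio)
    _ = _ := measure_predCount_lt_of_exchangeable (by fun_prop)
        (measurable_vars.comp (measurable_observed hf))
        (identDistrib_refVars_observed Q.fst (μ.map (σ n)) (k n) hf) hq _

end Coverage

section Noise

theorem measureReal_le_abs_le_of_hasSubgaussianMGF {α : Type*} [MeasurableSpace α] {ν : Measure α}
    [IsFiniteMeasure ν] {Z : α → ℝ} {c : NNReal} (h : HasSubgaussianMGF Z c ν) {t : ℝ}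
    (ht : 0 ≤ t) :
    ν.real {w | t ≤ |Z w|} ≤ 2 * Real.exp (-t ^ 2 / (2 * c)) := by
  calc ν.real {w | t ≤ |Z w|} = ν.real ({w | t ≤ Z w} ∪ {w | t ≤ (-Z) w}) := by
        simp only [le_abs, Set.ofPred_or, Pi.neg_apply]
    _ ≤ ν.real {w | t ≤ Z w} + ν.real {w | t ≤ (-Z) w} := measureReal_union_le _ _
    _ ≤ 2 * Real.exp (-t ^ 2 / (2 * c)) := by
        rw [two_mul]
        exact add_le_add (h.measure_ge_le ht) (h.neg.measure_ge_le ht)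

theorem measurable_sgn_add {a : ℝ} : Measurable fun v : ℝ => (sgn (a + v) : ℝ) :=
  measurable_subtype_coe.comp (measurable_sgn.comp (measurable_const_add a))

theorem hasSubgaussianMGF_sub_sgn_add {a : ℝ} (ha : a ∈ Set.Icc (-1 : ℝ) 1) :
    HasSubgaussianMGF (fun v => a - (sgn (a + v) : ℝ)) 1 unif := by
  have centered := (hasSubgaussianMGF_of_mem_Icc (μ := unif) (a := -1) (b := 1)
    (measurable_sgn_add (a := a)).aemeasurable
    (.of_forall fun v => abs_le.1 (abs_label (sgn (a + v))).le)).neg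
  rw [integral_sgn_add_unif ha] at centered
  convert centered using 1
  · funext v
    simp
  · ext
    norm_num

variable {n : ℕ}

theorem hasSubgaussianMGF_average_noise {S : Finset (Fin n)} {k : ℕ} (hS : S.card ≤ k)
    {a : Fin n → ℝ} (ha : ∀ i, a i ∈ Set.Icc (-1 : ℝ) 1) :
    HasSubgaussianMGF (fun v : Fin n → ℝ => 1 / (k : ℝ) * ∑ l ∈ S, (a l - (sgn (a l + v l) : ℝ)))
      (1 / (k : NNReal)) (Measure.pi fun _ => unif) := by
  have noise_subgaussian (l : Fin n) : HasSubgaussianMGF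
      (fun v : Fin n → ℝ => a l - (sgn (a l + v l) : ℝ)) 1 (Measure.pi fun _ => unif) := by
    have eval := measurePreserving_eval (fun _ : Fin n => unif) l
    refine HasSubgaussianMGF.of_map (Y := fun v : Fin n → ℝ => v l)
      (X := fun v => a l - (sgn (a l + v) : ℝ)) eval.measurable.aemeasurable ?_
    exact eval.map_eq.symm ▸ hasSubgaussianMGF_sub_sgn_add (ha l)
  have noise_indep : iIndepFun (fun l (v : Fin n → ℝ) => a l - (sgn (a l + v l) : ℝ))
      (Measure.pi fun _ => unif) :=
    iIndepFun_pi (X := fun l (v : ℝ) => a l - (sgn (a l + v) : ℝ))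
      fun l => (measurable_sgn_add.const_sub _).aemeasurable
  have average := (HasSubgaussianMGF.sum_of_iIndepFun noise_indep (s := S) (c := fun _ => 1)
    fun l _ => noise_subgaussian l).const_mul (1 / (k : ℝ))
  refine ⟨average.integrable_exp_mul, fun t => (average.mgf_le t).trans ?_⟩
  gcongr
  rw [← NNReal.coe_le_coe]
  have hS' : (S.card : ℝ) ≤ k := by exact_mod_cast hS
  calc (1 / (k : ℝ)) ^ 2 * ((∑ _l ∈ S, (1 : NNReal) : NNReal) : ℝ)
      ≤ (1 / (k : ℝ)) ^ 2 * k := by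
        gcongr
        simpa using hS'
    _ = ((1 / (k : NNReal) : NNReal) : ℝ) := by
        push_cast
        rcases eq_or_ne (k : ℝ) 0 with h | h
        · simp [h]
        · field_simp

variable {𝕏 : Type*} [PseudoMetricSpace 𝕏]

/-- At some data point the kNN average of the noise `g x_l - y_l` is at least `t` in absolute
value. -/
def NoiseGe (k : ℕ) (t : ℝ) (g : 𝕏 → ℝ) (s : Equiv.Perm (Fin n)) (D : Fin n → 𝕏 × Label) : Prop :=
  ∃ i, t ≤ |neighborAverage k s (fun l => (D l).1)
    ((fun l => g (D l).1) - fun l => ((D l).2 : ℝ)) (D i).1|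

theorem refVar_le_of_not_noiseGe {k : ℕ} {t : ℝ} {g : 𝕏 → ℝ} {s : Equiv.Perm (Fin n)}
    {D : Fin n → 𝕏 × Label} (h : ¬NoiseGe k t g s D) :
    refVar k s g D ≤ 2 * (meanSqResidual k s (fun l => (D l).1) (fun l => g (D l).1)
      (fun l => g (D l).1) + t ^ 2) := by
  simp only [NoiseGe, not_exists, not_le] at h
  exact meanSqResidual_le_bias_add_noise k s _ fun i => (h i).le

theorem pi_unif_noiseGe_labelled_le {g : 𝕏 → ℝ} (hg1 : ∀ x, g x ∈ Set.Icc (-1 : ℝ) 1) (k : ℕ)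
    (s : Equiv.Perm (Fin n)) (x : Fin n → 𝕏) {t : ℝ} (ht : 0 ≤ t) :
    (Measure.pi fun _ => unif) {v | NoiseGe k t g s (labelled g x v)} ≤
      ENNReal.ofReal (n * (2 * Real.exp (-(t ^ 2 / 2 * k)))) := by
  rw [ENNReal.le_ofReal_iff_toReal_le (measure_ne_top _ _) (by positivity), ← measureReal_def]
  have noise_le (i : Fin n) : (Measure.pi fun _ => unif).real {v : Fin n → ℝ | t ≤ |1 / (k : ℝ) *
      ∑ l ∈ neighbors k s x (x i), (g (x l) - (sgn (g (x l) + v l) : ℝ))|} ≤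
      2 * Real.exp (-(t ^ 2 / 2 * k)) := by
    have card_le : (neighbors k s x (x i)).card ≤ k :=
      (card_neighbors k s x (x i)).trans_le (min_le_left k n)
    refine (measureReal_le_abs_le_of_hasSubgaussianMGF
      (hasSubgaussianMGF_average_noise card_le fun l => hg1 (x l)) ht).trans_eq ?_
    congr 2
    push_cast
    simp only [div_eq_mul_inv, mul_inv, inv_inv]
    ring
  calc (Measure.pi fun _ => unif).real {v | NoiseGe k t g s (labelled g x v)}
      = (Measure.pi fun _ => unif).real (⋃ i, {v : Fin n → ℝ | t ≤ |1 / (k : ℝ) *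
        ∑ l ∈ neighbors k s x (x i), (g (x l) - (sgn (g (x l) + v l) : ℝ))|}) := by
        rw [← Set.ofPred_exists]
        rfl
    _ ≤ ∑ _i : Fin n, 2 * Real.exp (-(t ^ 2 / 2 * k)) :=
        (measureReal_iUnion_fintype_le _).trans (Finset.sum_le_sum fun i _ => noise_le i)
    _ = n * (2 * Real.exp (-(t ^ 2 / 2 * k))) := by simp

variable [MeasurableSpace 𝕏] [OpensMeasurableSpace 𝕏] [SecondCountableTopology 𝕏] {r : ℕ}

theorem measurableSet_noiseGe {α : Type*} [MeasurableSpace α] (k : ℕ) (t : ℝ) {g : 𝕏 → ℝ}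
    (hg : Measurable g) {s : α → Equiv.Perm (Fin n)} (hs : Measurable s)
    {D : α → Fin n → 𝕏 × Label} (hD : Measurable D) :
    MeasurableSet {w | NoiseGe k t g (s w) (D w)} := by
  have hD' (i) : Measurable fun w => D w i := (measurable_pi_apply i).comp hD
  simp only [NoiseGe, Set.ofPred_exists]
  refine MeasurableSet.iUnion fun i => measurableSet_le measurable_const (Measurable.abs ?_)
  exact measurable_neighborAverage k hs (measurable_pi_lambda _ fun l => (hD' l).fst)
    (measurable_pi_lambda _ fun l => (hg.comp (hD' l).fst).sub
      (measurable_subtype_coe.comp (hD' l).snd)) (hD' i).fst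

theorem measure_prod_le {α β : Type*} [MeasurableSpace α] [MeasurableSpace β] {μ : Measure α}
    [IsProbabilityMeasure μ] {ν : Measure β} [SFinite ν] {A : Set (α × β)} (hA : MeasurableSet A)
    {c : ℝ≥0∞} (h : ∀ x, ν (Prod.mk x ⁻¹' A) ≤ c) : μ.prod ν A ≤ c := by
  rw [Measure.prod_apply hA]
  exact (lintegral_mono h).trans_eq (by simp)

theorem seedLaw_noiseGe_le (P : Measure 𝕏) [IsProbabilityMeasure P]
    (S : Measure (Equiv.Perm (Fin n))) [IsProbabilityMeasure S] {g : 𝕏 → ℝ} (hg : Measurable g)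
    (hg1 : ∀ x, g x ∈ Set.Icc (-1 : ℝ) 1) (k : ℕ) {t : ℝ} (ht : 0 ≤ t) (j : Fin (r + 1)) :
    seedLaw P r S {w | NoiseGe k t g w.2.2.2 (labelled g w.1 (w.2.1 j))} ≤
      ENNReal.ofReal (n * (2 * Real.exp (-(t ^ 2 / 2 * k)))) := by
  have hA : MeasurableSet {w : Seed 𝕏 n r | NoiseGe k t g w.2.2.2 (labelled g w.1 (w.2.1 j))} :=
    measurableSet_noiseGe k t hg (by fun_prop) ((measurable_labelled hg).comp
      (f := fun w : Seed 𝕏 n r => (w.1, w.2.1 j)) (by fun_prop))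
  have : SFinite ((Measure.pi fun _ : Fin (r + 1) => Measure.pi fun _ : Fin n => unif).prod
    ((uniformOn (Set.univ : Set (Equiv.Perm (Fin (r + 1))))).prod S)) := Measure.prod.instSFinite
  refine measure_prod_le hA fun x => ?_
  have hAx := measurable_prodMk_left (x := x) hA
  rw [← Measure.prod_swap, Measure.map_apply measurable_swap hAx]
  refine measure_prod_le (measurable_swap hAx) fun ps => ?_
  have eval := measurePreserving_eval
    (fun _ : Fin (r + 1) => Measure.pi fun _ : Fin n => unif) j
  calc _ = (Measure.pi fun _ => unif) {v : Fin n → ℝ | NoiseGe k t g ps.2 (labelled g x v)} :=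
        eval.measure_preimage (measurableSet_noiseGe k t hg measurable_const
          ((measurable_labelled hg).comp (f := fun v => (x, v)) (by fun_prop))).nullMeasurableSet
    _ ≤ _ := pi_unif_noiseGe_labelled_le hg1 k ps.2 x ht

theorem summable_mul_exp_neg {k : ℕ → ℕ}
    (hk : Tendsto (fun n : ℕ => (k n : ℝ) / Real.log n) atTop atTop) {c : ℝ} (hc : 0 < c) :
    Summable fun n : ℕ => (n : ℝ) * (2 * Real.exp (-(c * k n))) := by
  refine summable_of_isBigO_nat (g := fun n : ℕ => 1 / (n : ℝ) ^ 2)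
    (Real.summable_one_div_nat_pow.2 one_lt_two) (.of_bound 2 ?_)
  filter_upwards [hk.eventually_ge_atTop (3 / c), eventually_gt_atTop 1] with n hkn hn
  have hn0 : (0 : ℝ) < n := by positivity
  have log_pos : 0 < Real.log n := Real.log_pos (by exact_mod_cast hn)
  have exponent_le : -(c * k n) ≤ -(3 * Real.log n) := by
    rw [div_le_div_iff₀ hc log_pos] at hkn
    linarith
  have exp_le : Real.exp (-(c * k n)) ≤ 1 / (n : ℝ) ^ 3 := calc
    Real.exp (-(c * k n)) ≤ Real.exp (-(3 * Real.log n)) := Real.exp_le_exp.2 exponent_le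
    _ = 1 / (n : ℝ) ^ 3 := by
      rw [Real.exp_neg, mul_comm, Real.exp_mul, Real.exp_log hn0, one_div]
      norm_cast
  rw [Real.norm_of_nonneg (by positivity), Real.norm_of_nonneg (by positivity)]
  calc (n : ℝ) * (2 * Real.exp (-(c * k n))) ≤ n * (2 * (1 / (n : ℝ) ^ 3)) := by gcongr
    _ = 2 * (1 / (n : ℝ) ^ 2) := by field_simp

variable {Ω : Type*} [MeasurableSpace Ω] {μ : Measure Ω} [IsProbabilityMeasure μ]
  {Q : Measure (𝕏 × Label)} [IsProbabilityMeasure Q] {X : ℕ → Ω → 𝕏} {Y : ℕ → Ω → Label}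
  {U : (n : ℕ) → Fin n → Fin r → Ω → ℝ} {π : ℕ → Ω → Equiv.Perm (Fin (r + 1))}
  {σ : (n : ℕ) → Ω → Equiv.Perm (Fin n)} {g h : 𝕏 → ℝ} {j : Fin (r + 1)}

theorem measure_noiseGe_datasets_le (hs : IsIIDSample μ Q X Y)
    (hi : IsInitialization μ X Y U π σ)
    (hQ : IsRegressionFunction Q h) (hh : Measurable h) (hh1 : ∀ x, h x ∈ Set.Icc (-1 : ℝ) 1)
    (hg : Measurable g) (hg1 : ∀ x, g x ∈ Set.Icc (-1 : ℝ) 1)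
    (hgh : j = Fin.last r → g = h) (k : ℕ) {t : ℝ} (ht : 0 ≤ t) (n : ℕ) :
    μ {ω | NoiseGe k t g (σ n ω) (datasets g (observation X Y U π σ n ω) j)} ≤
      ENNReal.ofReal (n * (2 * Real.exp (-(t ^ 2 / 2 * k)))) := by
  have := Measure.isProbabilityMeasure_map (hi.measurable_σ n).aemeasurable (μ := μ)
  have transfer := (hs.identDistrib_observation hi hQ hh hh1 n).measure_mem_eq
    (s := {o | NoiseGe k t g o.2.2.2 (datasets g o j)}) (measurableSet_noiseGe k t hg (by fun_prop)
      ((measurable_pi_apply j).comp (measurable_datasets hg)))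
  refine transfer.trans_le ?_
  simp only [Set.preimage_ofPred_eq, datasets_observed hgh]
  exact seedLaw_noiseGe_le Q.fst (μ.map (σ n)) hg hg1 k ht j

theorem ae_eventually_not_noiseGe (hs : IsIIDSample μ Q X Y)
    (hi : IsInitialization μ X Y U π σ)
    (hQ : IsRegressionFunction Q h) (hh : Measurable h) (hh1 : ∀ x, h x ∈ Set.Icc (-1 : ℝ) 1)
    (hg : Measurable g) (hg1 : ∀ x, g x ∈ Set.Icc (-1 : ℝ) 1)
    (hgh : j = Fin.last r → g = h) {k : ℕ → ℕ}
    (hk : Tendsto (fun n : ℕ => (k n : ℝ) / Real.log n) atTop atTop) {t : ℝ} (ht : 0 < t) :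
    ∀ᵐ ω ∂μ, ∀ᶠ n in atTop,
      ¬NoiseGe (k n) t g (σ n ω) (datasets g (observation X Y U π σ n ω) j) :=
  ae_eventually_notMem <| ne_top_of_le_ne_top
    (summable_mul_exp_neg hk (c := t ^ 2 / 2) (by positivity)).tsum_ofReal_ne_top
    (ENNReal.tsum_le_tsum fun n =>
      measure_noiseGe_datasets_le hs hi hQ hh hh1 hg hg1 hgh (k n) ht.le n)

end Noise

section LawOfLargeNumbers

variable {𝕏 Ω : Type*} [MeasurableSpace 𝕏] [MeasurableSpace Ω] {μ : Measure Ω} {P : Measure 𝕏}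
  {X : ℕ → Ω → 𝕏}

theorem ae_tendsto_avg (hX : ∀ i, MeasurePreserving (X i) μ P)
    (hind : Pairwise fun i j => IndepFun (X i) (X j) μ) {φ : 𝕏 → ℝ} (hφ : Measurable φ)
    (hint : Integrable φ P) :
    ∀ᵐ ω ∂μ, Tendsto (fun n : ℕ => 1 / (n : ℝ) * ∑ i : Fin n, φ (X i ω)) atTop
      (𝓝 (∫ x, φ x ∂P)) := by
  have identDistrib (i) : IdentDistrib (X i) (X 0) μ μ :=
    ⟨(hX i).aemeasurable, (hX 0).aemeasurable, (hX i).map_eq.trans (hX 0).map_eq.symm⟩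
  have strong_law := strong_law_ae_real (fun i ω => φ (X i ω)) ((hX 0).integrable_comp_of_integrable
    hint) (fun i j hij => (hind hij).comp hφ hφ) fun i => (identDistrib i).comp hφ
  have integral_eq : ∫ ω, φ (X 0 ω) ∂μ = ∫ x, φ x ∂P := by
    rw [← (hX 0).map_eq, integral_map (hX 0).aemeasurable hφ.aestronglyMeasurable]
  filter_upwards [strong_law] with ω hω
  rw [integral_eq] at hω
  exact hω.congr fun n => by rw [Finset.sum_range, one_div, inv_mul_eq_div]

variable [IsProbabilityMeasure P] {A : Set 𝕏}

open Classical in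
theorem ae_tendsto_freq (hX : ∀ i, MeasurePreserving (X i) μ P)
    (hind : Pairwise fun i j => IndepFun (X i) (X j) μ) (hA : MeasurableSet A) :
    ∀ᵐ ω ∂μ, Tendsto (fun n : ℕ => (Finset.card {i : Fin n | X i ω ∈ A} : ℝ) / n) atTop
      (𝓝 (P.real A)) := by
  filter_upwards [ae_tendsto_avg hX hind (measurable_one.indicator hA)
    ((integrable_const (1 : ℝ)).indicator hA)] with ω hω
  rw [integral_indicator_one hA] at hω
  refine hω.congr fun n => ?_
  rw [Finset.card_filter, one_div, inv_mul_eq_div]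
  simp [Set.indicator_apply]

open Classical in
theorem ae_eventually_le_card_mem (hX : ∀ i, MeasurePreserving (X i) μ P)
    (hind : Pairwise fun i j => IndepFun (X i) (X j) μ) {k : ℕ → ℕ}
    (hk : Tendsto (fun n : ℕ => (k n : ℝ) / n) atTop (𝓝 0)) (hA : MeasurableSet A) :
    ∀ᵐ ω ∂μ, ∀ᶠ n in atTop, (∃ i : Fin n, X i ω ∈ A) →
      k n ≤ Finset.card {i : Fin n | X i ω ∈ A} := by
  rcases eq_or_ne (P A) 0 with null | not_null
  · have never_mem : ∀ᵐ ω ∂μ, ∀ i, X i ω ∉ A := ae_all_iff.2 fun i =>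
      (hX i).quasiMeasurePreserving.ae (measure_eq_zero_iff_ae_notMem.1 null)
    filter_upwards [never_mem] with ω hω
    exact .of_forall fun n ⟨i, hi⟩ => absurd hi (hω i)
  · have real_pos : 0 < P.real A := ENNReal.toReal_pos not_null (measure_ne_top _ _)
    filter_upwards [ae_tendsto_freq hX hind hA] with ω hω
    filter_upwards [hk.eventually_lt hω real_pos, eventually_gt_atTop 0] with n hkn hn _
    have hn0 : (0 : ℝ) < n := by exact_mod_cast hn
    exact_mod_cast ((div_lt_div_iff_of_pos_right hn0).1 hkn).le

end LawOfLargeNumbers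

section Distinct

variable {𝕏 Ω : Type*} [MetricSpace 𝕏] [MeasurableSpace 𝕏]

theorem nullSingletonClass_of_ae_dist_ne {P : Measure 𝕏} [SFinite P]
    (h : ∀ᵐ p ∂P.prod (P.prod P), dist p.1 p.2.1 ≠ dist p.1 p.2.2) :
    NullSingletonClass P where
  measure_singleton a := by
    have atom_null : P.prod (P.prod P) ({a} ×ˢ ({a} ×ˢ {a})) = 0 := by
      refine measure_mono_null ?_ (ae_iff.1 h)
      rintro ⟨x, y, z⟩ ⟨-, hy, hz⟩
      simp only [Set.mem_singleton_iff] at hy hz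
      simp [hy, hz]
    simpa only [Measure.prod_prod, mul_eq_zero, or_self] using atom_null

variable [SecondCountableTopology 𝕏] [BorelSpace 𝕏] [MeasurableSpace Ω] {μ : Measure Ω}
  [IsFiniteMeasure μ] {P : Measure 𝕏} [IsProbabilityMeasure P] {X : ℕ → Ω → 𝕏}

theorem ae_injective [NullSingletonClass P] (hX : ∀ i, MeasurePreserving (X i) μ P)
    (hind : Pairwise fun i j => IndepFun (X i) (X j) μ) :
    ∀ᵐ ω ∂μ, Function.Injective fun i => X i ω := by
  have off_diagonal : ∀ᵐ p ∂P.prod P, p.1 ≠ p.2 := by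
    refine (Measure.ae_prod_iff_ae_ae ?_).2 (.of_forall fun x => ?_)
    · exact (isClosed_eq continuous_fst continuous_snd).measurableSet.compl
    · filter_upwards [measure_eq_zero_iff_ae_notMem.1 (measure_singleton (μ := P) x)] with y hy
      exact fun hxy => hy hxy.symm
  have pairwise_ne : ∀ᵐ ω ∂μ, ∀ i j, i ≠ j → X i ω ≠ X j ω := by
    simp only [ae_all_iff]
    intro i j hij
    have joint_law := (indepFun_iff_map_prod_eq_prod_map_map (hX i).aemeasurable
      (hX j).aemeasurable).1 (hind hij)
    rw [(hX i).map_eq, (hX j).map_eq] at joint_law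
    rw [← joint_law] at off_diagonal
    exact ae_of_ae_map ((hX i).measurable.prodMk (hX j).measurable).aemeasurable off_diagonal
  filter_upwards [pairwise_ne] with ω hω i j hij
  exact not_imp_not.1 (hω i j) hij

end Distinct

section Oscillation

theorem tendsto_zero_of_eventually_le {u : ℕ → ℝ} (hu : ∀ n, 0 ≤ u n) {v : ℕ → ℕ → ℝ} {c : ℕ → ℝ}
    (huv : ∀ m, ∀ᶠ n in atTop, u n ≤ v m n) (hv : ∀ m, Tendsto (v m) atTop (𝓝 (c m)))
    (hc : Tendsto c atTop (𝓝 0)) : Tendsto u atTop (𝓝 0) := by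
  refine tendsto_order.2 ⟨fun a ha => .of_forall fun n => ha.trans_le (hu n), fun a ha => ?_⟩
  obtain ⟨m, hm⟩ := (hc.eventually_lt_const ha).exists
  filter_upwards [huv m, (hv m).eventually_lt_const hm] with n h₁ h₂
  exact h₁.trans_lt h₂

theorem tendsto_measureReal_compl_accumulate {α : Type*} [MeasurableSpace α] {P : Measure α}
    [IsProbabilityMeasure P] {A : ℕ → Set α} (hA : ∀ j, MeasurableSet (A j))
    (cover : ⋃ j, A j = Set.univ) :
    Tendsto (fun J => P.real (Set.accumulate A J)ᶜ) atTop (𝓝 0) := by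
  have exhaust := (ENNReal.tendsto_toReal (measure_ne_top P _)).comp
    (tendsto_measure_iUnion_accumulate (μ := P) (f := A))
  rw [cover, ← measureReal_def, probReal_univ] at exhaust
  have compl_eq (J) : P.real (Set.accumulate A J)ᶜ = 1 - P.real (Set.accumulate A J) :=
    probReal_compl_eq_one_sub (.biUnion (Set.to_countable _) fun j _ => hA j)
  simpa only [compl_eq, sub_self] using! exhaust.const_sub 1

variable {𝕏 : Type*} [PseudoMetricSpace 𝕏]

theorem exists_countable_cover_of_continuous [SecondCountableTopology 𝕏] [Nonempty 𝕏] {h : 𝕏 → ℝ}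
    (hh : Continuous h) {ε : ℝ} (hε : 0 < ε) :
    ∃ (c : ℕ → 𝕏) (ρ : ℕ → ℝ), (⋃ j, Metric.ball (c j) (ρ j)) = Set.univ ∧
      ∀ j, ∀ y ∈ Metric.ball (c j) (3 * ρ j), |h y - h (c j)| < ε := by
  choose δ hδ hδε using fun x => Metric.continuous_iff.1 hh x ε hε
  obtain ⟨S, hS, cover⟩ := TopologicalSpace.countable_cover_nhds fun x : 𝕏 =>
    Metric.ball_mem_nhds x (ε := δ x / 3) (div_pos (hδ x) three_pos)
  have S_nonempty : S.Nonempty := by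
    rw [Set.nonempty_iff_ne_empty]
    rintro rfl
    exact Set.empty_ne_univ (by rwa [Set.biUnion_empty] at cover)
  obtain ⟨c, rfl⟩ := hS.exists_eq_range S_nonempty
  refine ⟨c, fun j => δ (c j) / 3, by rwa [Set.biUnion_range] at cover, fun j y hy => ?_⟩
  exact hδε (c j) y (by rwa [mul_div_cancel₀ _ three_ne_zero] at hy)

open Classical in
theorem mem_ball_of_mem_neighbors {n k : ℕ} {s : Equiv.Perm (Fin n)} {xs : Fin n → 𝕏} {x c : 𝕏}
    {ρ : ℝ} {i : Fin n} (hx : x ∈ Metric.ball c ρ)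
    (hk : k ≤ Finset.card {l | xs l ∈ Metric.ball c ρ}) (hi : i ∈ neighbors k s xs x) :
    xs i ∈ Metric.ball c (3 * ρ) := by
  have dist_le : dist (xs i) x ≤ 2 * ρ := dist_le_of_mem_neighbors hi (fun l hl => by
    rw [Finset.mem_filter_univ, Metric.mem_ball] at hl
    linarith [dist_triangle_right (xs l) x c, Metric.mem_ball.1 hx]) hk
  rw [Metric.mem_ball] at hx ⊢
  linarith [dist_triangle (xs i) x c]

variable [SecondCountableTopology 𝕏] [MeasurableSpace 𝕏] [OpensMeasurableSpace 𝕏] {Ω : Type*}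
  [MeasurableSpace Ω] {μ : Measure Ω} {P : Measure 𝕏} [IsProbabilityMeasure P] {X : ℕ → Ω → 𝕏}

open Classical in
theorem ae_tendsto_freq_oscillation (hX : ∀ i, MeasurePreserving (X i) μ P)
    (hind : Pairwise fun i j => IndepFun (X i) (X j) μ) {k : ℕ → ℕ}
    (hk : Tendsto (fun n : ℕ => (k n : ℝ) / n) atTop (𝓝 0)) {h : 𝕏 → ℝ} (hh : Continuous h)
    {ε : ℝ} (hε : 0 < ε) :
    ∀ᵐ ω ∂μ, ∀ s : (n : ℕ) → Equiv.Perm (Fin n), Tendsto (fun n : ℕ =>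
      (Finset.card {i : Fin n | ∃ l ∈ neighbors (k n) (s n) (fun l : Fin n => X l ω) (X i ω),
        ε < |h (X i ω) - h (X l ω)|} : ℝ) / n) atTop (𝓝 0) := by
  have : Nonempty 𝕏 := nonempty_of_isProbabilityMeasure P
  obtain ⟨c, ρ, cover, small⟩ := exists_countable_cover_of_continuous hh (half_pos hε)
  let A (j : ℕ) : Set 𝕏 := Metric.ball (c j) (ρ j)
  have hA (j) : MeasurableSet (A j) := measurableSet_ball
  have hrest (J) : MeasurableSet (Set.accumulate A J)ᶜ :=
    (MeasurableSet.biUnion (Set.to_countable _) fun j _ => hA j).compl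
  have freq_rest := ae_all_iff.2 fun J => ae_tendsto_freq hX hind (hrest J)
  filter_upwards [freq_rest, ae_all_iff.2 fun j => ae_eventually_le_card_mem hX hind hk (hA j)]
    with ω hfreq hcard s
  refine tendsto_zero_of_eventually_le (fun n => by positivity) (fun J => ?_) hfreq
    (tendsto_measureReal_compl_accumulate hA cover)
  filter_upwards [(Set.finite_Iic J).eventually_all.2 fun j _ => hcard j] with n hn
  gcongr with i
  rintro ⟨l, hl, hosc⟩ hmem
  obtain ⟨j, hj, hij⟩ := Set.mem_accumulate.1 hmem
  have near_i := small j (X i ω)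
    (Metric.ball_subset_ball (by linarith [Metric.pos_of_mem_ball hij]) hij)
  have near_l := small j (X l ω) (mem_ball_of_mem_neighbors hij (hn j hj ⟨i, hij⟩) hl)
  have := abs_sub_le (h (X i ω)) (h (c j)) (h (X l ω))
  rw [abs_sub_comm (h (c j))] at this
  linarith

end Oscillation

section Bias

theorem exists_boundedContinuous_integral_sq_sub_le {α : Type*} [TopologicalSpace α]
    [NormalSpace α] [MeasurableSpace α] [BorelSpace α] {P : Measure α} [P.WeaklyRegular]
    {g : α → ℝ} (hg : MemLp g 2 P) {ε : ℝ} (hε : 0 < ε) :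
    ∃ h : BoundedContinuousFunction α ℝ, MemLp h 2 P ∧ ∫ x, (h x - g x) ^ 2 ∂P ≤ ε := by
  obtain ⟨h, dist_le, hh⟩ := hg.exists_boundedContinuous_eLpNorm_sub_le (by simp)
    (ENNReal.ofReal_pos.2 (Real.sqrt_pos.2 hε)).ne'
  refine ⟨h, hh, ?_⟩
  rw [eLpNorm_sub_comm, (hh.sub hg).eLpNorm_eq_integral_rpow_norm (by simp) (by simp),
    ENNReal.ofReal_le_ofReal_iff (Real.sqrt_nonneg _)] at dist_le
  simp only [ENNReal.toReal_ofNat, Real.rpow_ofNat, Pi.sub_apply, Real.norm_eq_abs, sq_abs,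
    ← one_div, ← Real.sqrt_eq_rpow] at dist_le
  exact (Real.sqrt_le_sqrt_iff hε.le).1 dist_le

variable {𝕏 Ω : Type*} [MetricSpace 𝕏] [SecondCountableTopology 𝕏] [MeasurableSpace 𝕏]
  [BorelSpace 𝕏] [MeasurableSpace Ω] {μ : Measure Ω} {P : Measure 𝕏} [IsProbabilityMeasure P]
  {X : ℕ → Ω → 𝕏} {k : ℕ → ℕ}

theorem ae_tendsto_bias_of_boundedContinuous (hX : ∀ i, MeasurePreserving (X i) μ P)
    (hind : Pairwise fun i j => IndepFun (X i) (X j) μ)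
    (hk : Tendsto (fun n : ℕ => (k n : ℝ) / n) atTop (𝓝 0)) (hk0 : ∀ᶠ n in atTop, 0 < k n)
    (h : BoundedContinuousFunction 𝕏 ℝ) :
    ∀ᵐ ω ∂μ, ∀ s : (n : ℕ) → Equiv.Perm (Fin n), Tendsto (fun n : ℕ =>
      meanSqResidual (k n) (s n) (fun l : Fin n => X l ω) (fun l => h (X l ω))
        (fun l => h (X l ω))) atTop (𝓝 0) := by
  classical
  have k_le : ∀ᶠ n in atTop, k n ≤ n := by
    filter_upwards [hk.eventually_lt_const one_pos, eventually_gt_atTop 0] with n hkn hn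
    rw [div_lt_one (by exact_mod_cast hn)] at hkn
    exact_mod_cast hkn.le
  filter_upwards [ae_all_iff.2 fun m : ℕ =>
    ae_tendsto_freq_oscillation hX hind hk h.continuous (Nat.one_div_pos_of_nat (n := m))]
    with ω osc s
  refine tendsto_zero_of_eventually_le (fun n => meanSqResidual_nonneg _ _ _ _ _) (fun m => ?_)
    (fun m => ((osc m s).const_mul ((2 * ‖h‖) ^ 2)).const_add ((1 / ((m : ℝ) + 1)) ^ 2)) ?_
  · filter_upwards [hk0, k_le] with n hn hkn
    exact meanSqResidual_self_le_of_abs_le (s n) _ hn hkn fun l => h.norm_coe_le_norm (X l ω)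
  · simpa only [mul_zero, add_zero, zero_pow two_ne_zero] using
      (tendsto_one_div_add_atTop_nhds_zero_nat (𝕜 := ℝ)).pow 2

theorem HasStoneBound.ae_tendsto_bias {γ : ℕ} (hγ : HasStoneBound 𝕏 γ)
    (hX : ∀ i, MeasurePreserving (X i) μ P)
    (hind : Pairwise fun i j => IndepFun (X i) (X j) μ)
    (hinj : ∀ᵐ ω ∂μ, Function.Injective fun i => X i ω)
    (hk : Tendsto (fun n : ℕ => (k n : ℝ) / n) atTop (𝓝 0)) (hk0 : ∀ᶠ n in atTop, 0 < k n)
    {g : 𝕏 → ℝ} (hg : Measurable g) (hg2 : MemLp g 2 P) :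
    ∀ᵐ ω ∂μ, ∀ s : (n : ℕ) → Equiv.Perm (Fin n), Tendsto (fun n : ℕ =>
      meanSqResidual (k n) (s n) (fun l : Fin n => X l ω) (fun l => g (X l ω))
        (fun l => g (X l ω))) atTop (𝓝 0) := by
  choose h hh2 hhg using fun m : ℕ =>
    exists_boundedContinuous_integral_sq_sub_le hg2 (Nat.one_div_pos_of_nat (n := m))
  have approx_error := ae_all_iff.2 fun m => ae_tendsto_avg hX hind
    (((h m).continuous.measurable.sub hg).pow_const 2) ((hh2 m).sub hg2).integrable_sq
  filter_upwards [hinj, approx_error,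
    ae_all_iff.2 fun m => ae_tendsto_bias_of_boundedContinuous hX hind hk hk0 (h m)]
    with ω hω error bias s
  refine tendsto_zero_of_eventually_le (fun n => meanSqResidual_nonneg _ _ _ _ _)
    (fun m => .of_forall fun n => ?_)
    (fun m => ((bias m s).add ((error m).const_mul (2 * (1 + (γ : ℝ))))).const_mul 2) ?_
  · have triangle := meanSqResidual_sub_le (k n) (s n) (fun l : Fin n => X l ω)
      (fun l => h m (X l ω)) (fun l => h m (X l ω) - g (X l ω))
      (fun l => h m (X l ω)) (fun l => h m (X l ω) - g (X l ω))
    simp only [Pi.sub_def, sub_sub_cancel] at triangle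
    refine triangle.trans ?_
    gcongr
    exact hγ.meanSqResidual_self_le (k n) (s n) (hω.comp Fin.val_injective) _
  · have error_zero : Tendsto (fun m => ∫ x, (h m x - g x) ^ 2 ∂P) atTop (𝓝 0) :=
      squeeze_zero (fun m => integral_nonneg fun x => sq_nonneg _) hhg
        tendsto_one_div_add_atTop_nhds_zero_nat
    simpa using! (error_zero.const_mul (2 * (1 + (γ : ℝ)))).const_mul 2

end Bias

section Consistency

theorem tendsto_div_log_of_tendsto_sq_div_rpow {k : ℕ → ℕ} {δ : ℝ} (hδ : 0 < δ)
    (hk : Tendsto (fun n : ℕ => (k n : ℝ) ^ 2 / (n : ℝ) ^ (1 + δ)) atTop atTop) :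
    Tendsto (fun n : ℕ => (k n : ℝ) / Real.log n) atTop atTop := by
  have log_div_sqrt : Tendsto (fun n : ℕ => Real.log n / (n : ℝ) ^ (1 / 2 : ℝ)) atTop (𝓝 0) :=
    (isLittleO_log_rpow_atTop one_half_pos).tendsto_div_nhds_zero.comp tendsto_natCast_atTop_atTop
  have log_div_sqrt_pos : ∀ᶠ n : ℕ in atTop, 0 < Real.log n / (n : ℝ) ^ (1 / 2 : ℝ) := by
    filter_upwards [eventually_gt_atTop 1] with n hn
    have log_pos : 0 < Real.log n := Real.log_pos (by exact_mod_cast hn)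
    positivity
  have sqrt_div_log : Tendsto (fun n : ℕ => (n : ℝ) ^ (1 / 2 : ℝ) / Real.log n) atTop atTop :=
    (tendsto_nhdsWithin_iff.2 ⟨log_div_sqrt, log_div_sqrt_pos⟩).inv_tendsto_nhdsGT_zero.congr
      fun n => inv_div _ _
  refine tendsto_atTop_mono' atTop ?_ sqrt_div_log
  filter_upwards [hk.eventually_ge_atTop 1, eventually_ge_atTop 1] with n hkn hn
  have hn1 : (1 : ℝ) ≤ n := by exact_mod_cast hn
  have := Real.log_nonneg hn1
  gcongr
  rw [← Real.sqrt_eq_rpow, Real.sqrt_le_left (k n).cast_nonneg]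
  rw [one_le_div (by positivity)] at hkn
  exact (Real.self_le_rpow_of_one_le hn1 (by linarith)).trans hkn

variable {𝕏 Ω : Type*} [MeasurableSpace 𝕏] [MeasurableSpace Ω] {μ : Measure Ω}
  {Q : Measure (𝕏 × Label)} {X : ℕ → Ω → 𝕏} {Y : ℕ → Ω → Label}

theorem IsIIDSample.measurePreserving_input (hs : IsIIDSample μ Q X Y) (i : ℕ) :
    MeasurePreserving (X i) μ Q.fst where
  measurable := hs.measurable_X i
  map_eq := by
    rw [← hs.law i, Measure.fst_map_prodMk (hs.measurable_Y i)]

theorem IsIIDSample.pairwise_indepFun_input (hs : IsIIDSample μ Q X Y) :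
    Pairwise fun i j => IndepFun (X i) (X j) μ := fun _ _ hij =>
  (hs.indep.comp (fun _ => Prod.fst) fun _ => measurable_fst).indepFun hij

variable {r : ℕ} {U : (n : ℕ) → Fin n → Fin r → Ω → ℝ}
  {π : ℕ → Ω → Equiv.Perm (Fin (r + 1))} {σ : (n : ℕ) → Ω → Equiv.Perm (Fin n)} {k : ℕ → ℕ}
  [IsProbabilityMeasure μ] [MetricSpace 𝕏] [SecondCountableTopology 𝕏] [BorelSpace 𝕏]
  [IsProbabilityMeasure Q] [NullSingletonClass Q.fst] {γ : ℕ}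

theorem HasStoneBound.ae_tendsto_refVars (hγ : HasStoneBound 𝕏 γ) (hs : IsIIDSample μ Q X Y)
    (hi : IsInitialization μ X Y U π σ) {g h : 𝕏 → ℝ}
    (hQ : IsRegressionFunction Q h) (hh : Measurable h) (hh1 : ∀ x, h x ∈ Set.Icc (-1 : ℝ) 1)
    (hg : Measurable g) (hg1 : ∀ x, g x ∈ Set.Icc (-1 : ℝ) 1) {j : Fin (r + 1)}
    (hgh : j = Fin.last r → g = h) (hk : Tendsto (fun n : ℕ => (k n : ℝ) / n) atTop (𝓝 0))
    (hlog : Tendsto (fun n : ℕ => (k n : ℝ) / Real.log n) atTop atTop) :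
    ∀ᵐ ω ∂μ, Tendsto (fun n => refVars (k n) g (observation X Y U π σ n ω) j) atTop (𝓝 0) := by
  have k_pos : ∀ᶠ n in atTop, 0 < k n := by
    filter_upwards [hlog.eventually_gt_atTop 0] with n hn
    exact Nat.pos_of_ne_zero fun h0 => by simp [h0] at hn
  have hX := hs.measurePreserving_input
  have hind := hs.pairwise_indepFun_input
  have hg2 : MemLp g 2 Q.fst := .of_bound hg.aestronglyMeasurable 1
    (.of_forall fun x => abs_le.2 (hg1 x))
  filter_upwards [hγ.ae_tendsto_bias hX hind (ae_injective hX hind) hk k_pos hg hg2,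
    ae_all_iff.2 fun m : ℕ => ae_eventually_not_noiseGe hs hi hQ hh hh1 hg hg1 hgh hlog
      (Nat.one_div_pos_of_nat (n := m))] with ω bias noise
  refine tendsto_zero_of_eventually_le (fun n => meanSqResidual_nonneg _ _ _ _ _) (fun m => ?_)
    (fun m => ((bias fun n => σ n ω).add_const ((1 / ((m : ℝ) + 1)) ^ 2)).const_mul 2) ?_
  · filter_upwards [noise m] with n hn
    have refVar_le := refVar_le_of_not_noiseGe hn
    simp only [datasets_fst] at refVar_le
    exact refVar_le
  · simpa using! ((tendsto_one_div_add_atTop_nhds_zero_nat (𝕜 := ℝ)).pow 2).const_mul 2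

theorem HasStoneBound.ae_eventually_notMem_randomRegion {Θ : Type*} (hγ : HasStoneBound 𝕏 γ)
    (hs : IsIIDSample μ Q X Y) (hi : IsInitialization μ X Y U π σ) {f : Θ → 𝕏 → ℝ}
    (hf : ∀ θ, Measurable (f θ)) (hf1 : ∀ θ x, f θ x ∈ Set.Icc (-1 : ℝ) 1) {θ θ' : Θ}
    (hQ : IsRegressionFunction Q (f θ')) (hθ : sqDistQ Q (f θ) (f θ') ≠ 0) {q : ℕ}
    (hq : q < r + 1) (hk : Tendsto (fun n : ℕ => (k n : ℝ) / n) atTop (𝓝 0))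
    (hlog : Tendsto (fun n : ℕ => (k n : ℝ) / Real.log n) atTop atTop) :
    ∀ᵐ ω ∂μ, ∀ᶠ n in atTop, θ ∉ randomRegion f q k X Y U π σ n ω := by
  have dist_pos : 0 < sqDistQ Q (f θ) (f θ') :=
    lt_of_le_of_ne (integral_nonneg fun _ => sq_nonneg _) hθ.symm
  have memLp (θ) : MemLp (f θ) 2 Q.fst := .of_bound (hf θ).aestronglyMeasurable 1
    (.of_forall fun x => abs_le.2 (hf1 θ x))
  have ae_tendsto_refVars {θ₁ j} := hγ.ae_tendsto_refVars hs hi hQ (hf θ') (hf1 θ') (hf θ₁) (hf1 θ₁)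
    (j := j) (hk := hk) (hlog := hlog)
  have ae_tendsto_dist : ∀ᵐ ω ∂μ, Tendsto (fun n : ℕ => 1 / (n : ℝ) * ∑ i : Fin n,
      (f θ (X i ω) - f θ' (X i ω)) ^ 2) atTop (𝓝 (sqDistQ Q (f θ) (f θ'))) :=
    ae_tendsto_avg hs.measurePreserving_input hs.pairwise_indepFun_input
      (((hf θ).sub (hf θ')).pow_const 2) ((memLp θ).sub (memLp θ')).integrable_sq
  filter_upwards [ae_tendsto_dist,
    ae_tendsto_refVars (θ₁ := θ') (j := Fin.last r) fun _ => rfl,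
    ae_all_iff.2 fun j : Fin r => ae_tendsto_refVars (θ₁ := θ) (j := j.castSucc) fun h =>
      absurd h j.castSucc_ne_last] with ω distance true_residual alt_residual
  have gap (j : Fin r) := ((distance.sub (true_residual.const_mul 2)).sub
    ((alt_residual j).const_mul 2)).eventually_const_lt (by simpa using dist_pos)
  filter_upwards [eventually_all.2 gap] with n hn
  have triangle := mean_sq_sub_le_refVar_add_refVar (k n) (σ n ω) (f θ) (f θ')
    fun i : Fin n => (X i ω, Y i ω)
  have refVars_last (g : 𝕏 → ℝ) : refVars (k n) g (observation X Y U π σ n ω) (Fin.last r) =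
      refVar (k n) (σ n ω) g fun i : Fin n => (X i ω, Y i ω) :=
    congrArg (refVar (k n) (σ n ω) g) (Fin.snoc_last (α := fun _ => _) _ _)
  have last_of_all : predCount (lexKey (π n ω) (refVars (k n) (f θ) (observation X Y U π σ n ω)))
      (Fin.last r) = Fintype.card (Fin (r + 1)) - 1 := by
    refine predCount_eq_of_forall_lt fun b hb => lexKey_lt_lexKey.2 (.inl ?_)
    obtain ⟨j, rfl⟩ := Fin.exists_castSucc_eq.2 hb
    have := hn j
    rw [refVars_last] at this ⊢
    linarith
  rw [mem_randomRegion_iff, last_of_all, Fintype.card_fin]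
  lia

end Consistency

end KnnRegion

theorem theorem4_general {Ω : Type*} [MeasurableSpace Ω] (μ : Measure Ω) [IsProbabilityMeasure μ]
    {𝕏 : Type*} [MetricSpace 𝕏] [SecondCountableTopology 𝕏] [MeasurableSpace 𝕏] [BorelSpace 𝕏]
    (Q : Measure (𝕏 × KnnRegion.Label)) [IsProbabilityMeasure Q]
    (X : ℕ → Ω → 𝕏) (Y : ℕ → Ω → KnnRegion.Label)
    (hsample : KnnRegion.IsIIDSample μ Q X Y)
    {Θ : Type*} (f : Θ → 𝕏 → ℝ) (hf_meas : ∀ θ, Measurable (f θ))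
    (hf_range : ∀ θ x, f θ x ∈ Set.Icc (-1 : ℝ) 1)
    (θstar : Θ) (hstar : KnnRegion.IsRegressionFunction Q (f θstar)) (r : ℕ) (k : ℕ → ℕ)
    (U : (n : ℕ) → Fin n → Fin r → Ω → ℝ) (π : ℕ → Ω → Equiv.Perm (Fin (r + 1)))
    (σ : (n : ℕ) → Ω → Equiv.Perm (Fin n))
    (hinit : KnnRegion.IsInitialization μ X Y U π σ) (q : ℕ) (hq : q ≤ r + 1) :
    (∀ n, μ {ω | θstar ∈ KnnRegion.randomRegion f q k X Y U π σ n ω} =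
      (q : ℝ≥0∞) / ((r + 1 : ℕ) : ℝ≥0∞)) ∧
    (q < r + 1 →
      (∃ γ, KnnRegion.HasStoneBound 𝕏 γ) → NullSingletonClass Q.fst →
      Tendsto (fun n : ℕ => (k n : ℝ) / n) atTop (𝓝 0) →
      Tendsto (fun n : ℕ => (k n : ℝ) / Real.log n) atTop atTop →
      ∀ θ, KnnRegion.sqDistQ Q (f θ) (f θstar) ≠ 0 →
        μ (⋂ n : ℕ, ⋃ l ≥ n, {ω | θ ∈ KnnRegion.randomRegion f q k X Y U π σ l ω}) = 0) := by
  refine ⟨fun n => KnnRegion.measure_mem_randomRegion hsample hinit hstar (hf_meas θstar)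
    (hf_range θstar) hq k n, ?_⟩
  rintro hqr ⟨γ, hγ⟩ _ hk hlog θ hθ
  refine measure_mono_null ?_ (ae_iff.1 (hγ.ae_eventually_notMem_randomRegion hsample hinit
    hf_meas hf_range hstar hθ hqr hk hlog))
  exact fun ω hω => frequently_atTop.2 fun N => by
    simpa only [Set.mem_iUnion₂, exists_prop] using! Set.mem_iInter.1 hω N

theorem theorem4 {Ω : Type*} [MeasurableSpace Ω] (μ : Measure Ω) [IsProbabilityMeasure μ]
    -- the input space is a subset of `ℝᵈ`
    {d : ℕ} (𝕏 : Set (EuclideanSpace ℝ (Fin d)))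
    (Q : Measure (𝕏 × KnnRegion.Label)) [IsProbabilityMeasure Q]
    (X : ℕ → Ω → 𝕏) (Y : ℕ → Ω → KnnRegion.Label)
    (hsample : KnnRegion.IsIIDSample μ Q X Y)
    -- the candidate regression functions; the true one is among them, with parameter `θstar`
    {Θ : Type*} (f : Θ → 𝕏 → ℝ) (hf_meas : ∀ θ, Measurable (f θ))
    (hf_range : ∀ θ x, f θ x ∈ Set.Icc (-1 : ℝ) 1)
    (θstar : Θ) (hstar : KnnRegion.IsRegressionFunction Q (f θstar))
    (hinj : ∀ θ₁ θ₂, θ₁ ≠ θ₂ → KnnRegion.sqDistQ Q (f θ₁) (f θ₂) ≠ 0)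
    -- the algorithm: `m = r + 1` datasets, neighbour numbers `k n`, generated variables
    (r : ℕ) (k : ℕ → ℕ)
    (U : (n : ℕ) → Fin n → Fin r → Ω → ℝ) (π : ℕ → Ω → Equiv.Perm (Fin (r + 1)))
    (σ : (n : ℕ) → Ω → Equiv.Perm (Fin n))
    (hinit : KnnRegion.IsInitialization μ X Y U π σ)
    (q : ℕ) (hq : q ≤ r + 1) :
    -- exact coverage
    (∀ n, μ {ω | θstar ∈ KnnRegion.randomRegion f q k X Y U π σ n ω} =
      (q : ℝ≥0∞) / ((r + 1 : ℕ) : ℝ≥0∞)) ∧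
    -- strong pointwise consistency
    (q < r + 1 →
      Tendsto (fun n : ℕ => (k n : ℝ) / (n : ℝ)) atTop (𝓝 0) →
      (∃ δ : ℝ, 0 < δ ∧
        Tendsto (fun n : ℕ => (k n : ℝ) ^ 2 / (n : ℝ) ^ (1 + δ)) atTop atTop) →
      (∀ᵐ p ∂(Q.fst.prod (Q.fst.prod Q.fst)), dist p.1 p.2.1 ≠ dist p.1 p.2.2) →
      ∀ θ, θ ≠ θstar →
        μ (⋂ n : ℕ, ⋃ l ≥ n, {ω | θ ∈ KnnRegion.randomRegion f q k X Y U π σ l ω}) = 0) := by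
  obtain ⟨coverage, consistency⟩ := theorem4_general μ Q X Y hsample f hf_meas hf_range θstar hstar
    r k U π σ hinit q hq
  obtain ⟨γ, hγ⟩ := KnnRegion.exists_hasStoneBound (EuclideanSpace ℝ (Fin d))
  refine ⟨coverage, fun hqr hk ⟨δ, hδ, hkδ⟩ htie θ hθ => consistency hqr
    ⟨γ, hγ.of_isometry isometry_subtype_coe⟩ (KnnRegion.nullSingletonClass_of_ae_dist_ne htie) hk
    (KnnRegion.tendsto_div_log_of_tendsto_sq_div_rpow hδ hkδ) θ (hinj θ θstar hθ)⟩
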